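/- Let $\mathbb{H}^2=\{x\in\mathbb{R}^3:\ \langle x,x\rangle=-1,\ x_3>0\}$, $\langle x,y\rangle=x_1y_1+x_2y_2-x_3y_3$, be the hyperbolic plane (curvature $-1$), let $\mathbb{H}^2\times\mathbb{R}$ carry the product metric, let $\partial_z$ be the unit vertical field, and let $o=(0,0,1)\in\mathbb{H}^2$. A translating soliton is an orientable surface immersed in $\mathbb{H}^2\times\mathbb{R}$ (smooth, possibly with boundary) that has a unit normal field $\eta$ with $H=\langle\eta,\partial_z\rangle$, where $H$ is the mean curvature (half of the sum of the principal curvatures) with respect to $\eta$. A bowl soliton is an entire, upwards oriented vertical graph over $\mathbb{H}^2$ that is a translating soliton and is invariant under the rotations around the vertical axis $\{o\}\times\mathbb{R}$. A translation of $\mathbb{H}^2\times\mathbb{R}$ is a hyperbolic translation along a geodesic of $\mathbb{H}^2$ together with a vertical translation $z\mapsto z+h$. **Theorem.** Let $c\in\mathbb{H}^2$, let $l=\{c\}\times\mathbb{R}$, let $t_0\in\mathbb{R}$, and let $\Gamma\subset\mathbb{H}^2\times\{t_0\}$ be a closed embedded curve (the image of a topological embedding of the circle) that is invariant under all rotations around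 the vertical axis $l$. Let $M$ be a compact embedded translating soliton in $\mathbb{H}^2\times\mathbb{R}$ with boundary $\partial M=\Gamma$. Then $M$ is invariant under all rotations around $l$, and, up to translations, $M$ is a compact piece of the bowl soliton: there are a bowl soliton $\mathcal{B}$, a translation $T$ of $\mathbb{H}^2\times\mathbb{R}$ and a number $\sigma>0$ such that $$T(M)=\mathcal{B}\cap\{(x,z)\in\mathbb{H}^2\times\mathbb{R}:\ d_{\mathbb{H}^2}(o,x)\le\sigma\}.$$ -/

import Mathlib

open Set Topology
open scoped Manifold ContDiff

noncomputable section

/-- Lorentz--Minkowski space `L³`, with coordinates `(x 0, x 1, x 2)`. -/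
abbrev L3 : Type := Fin 3 → ℝ

/-- The flat ambient space `L³ × ℝ` that contains `ℍ² × ℝ`. -/
abbrev L3R : Type := L3 × ℝ

/-- The Euclidean plane, on which surfaces are modelled. -/
abbrev E2 : Type := EuclideanSpace ℝ (Fin 2)

/-- The Lorentz product `x₁y₁ + x₂y₂ - x₃y₃` of `L³`. -/
def lor (x y : L3) : ℝ := x 0 * y 0 + x 1 * y 1 - x 2 * y 2

/-- The product form `⟨·,·⟩_{L³} + dz²` on `L³ × ℝ`; on vectors tangent to `ℍ² × ℝ` it is the
Riemannian product metric of `ℍ² × ℝ`. -/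
def prodForm (V W : L3R) : ℝ := lor V.1 W.1 + V.2 * W.2

/-- The hyperbolic plane `ℍ²`, as the upper sheet of the hyperboloid in `L³`. -/
def H2 : Set L3 := {x | lor x x = -1 ∧ 0 < x 2}

/-- The Riemannian product `ℍ² × ℝ`. -/
def H2R : Set L3R := {P | P.1 ∈ H2}

/-- The origin `(0, 0, 1)` of `ℍ²`. -/
def origin : L3 := ![0, 0, 1]

/-- The hyperbolic distance of two points of `ℍ²`. -/
def hdist (x y : L3) : ℝ := Real.arcosh (-lor x y)

/-- The unit vertical Killing field `∂_z`. -/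
def vert : L3R := (0, 1)

/-- `A` is a rotation of `ℍ²` around `c ∈ ℍ²`: an orientation preserving linear isometry of `L³`
that fixes `c` (and hence preserves `ℍ²`). -/
structure IsRotationAbout (c : L3) (A : L3 →ₗ[ℝ] L3) : Prop where
  lor_map : ∀ x y, lor (A x) (A y) = lor x y
  det_eq : LinearMap.det A = 1
  map_center : A c = c

/-- `X ⊆ ℍ² × ℝ` is invariant under all rotations around the vertical axis `{c} × ℝ`. -/
def RotInvariant (c : L3) (X : Set L3R) : Prop :=
  ∀ A : L3 →ₗ[ℝ] L3, IsRotationAbout c A → (fun P : L3R => ((A P.1, P.2) : L3R)) '' X = X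

/-- `A` is a hyperbolic translation of `ℍ²`: for some geodesic
`t ↦ cosh t • p + sinh t • v` of `ℍ²` (with `p ∈ ℍ²` and `v` a unit tangent vector at `p`) and some
`s`, it moves the points of the geodesic by `s` along it, and it is the identity on the
orthogonal complement of the plane that contains the geodesic. -/
def IsHypTranslation (A : L3 →ₗ[ℝ] L3) : Prop :=
  ∃ p ∈ H2, ∃ v : L3, lor v v = 1 ∧ lor p v = 0 ∧ ∃ s : ℝ,
    A p = Real.cosh s • p + Real.sinh s • v ∧
    A v = Real.sinh s • p + Real.cosh s • v ∧
    ∀ w, lor p w = 0 → lor v w = 0 → A w = w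

/-- `T` is a translation of `ℍ² × ℝ`: a hyperbolic translation of the factor `ℍ²` together with a
translation of the factor `ℝ`. -/
def IsTranslation (T : L3R → L3R) : Prop :=
  ∃ A : L3 →ₗ[ℝ] L3, IsHypTranslation A ∧ ∃ h : ℝ, ∀ P, T P = (A P.1, P.2 + h)

section Surfaces

variable {H : Type*} [TopologicalSpace H] (I : ModelWithCorners ℝ E2 H)
  {S : Type*} [TopologicalSpace S] [ChartedSpace H S]

/-- The differential at `q` of a map of the surface `S` into `L³ × ℝ`, applied to the `i`-th vector
of the standard basis of `T_q S` (the coordinate basis of the preferred chart at `q`). -/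
def partialAt (f : S → L3R) (q : S) (i : Fin 2) : L3R :=
  let D : E2 →L[ℝ] L3R := mfderiv I 𝓘(ℝ, L3R) f q
  D (EuclideanSpace.single i 1)

/-- `ψ` is a smooth immersion of the surface `S` (possibly with boundary) into `ℍ² × ℝ`. -/
structure IsImmersedSurface (ψ : S → L3R) : Prop where
  mem : ∀ q, ψ q ∈ H2R
  smooth : ContMDiff I 𝓘(ℝ, L3R) ∞ ψ
  injective_mfderiv : ∀ q, Function.Injective (mfderiv I 𝓘(ℝ, L3R) ψ q)

/-- `η` is a smooth unit normal vector field, in `ℍ² × ℝ`, of the surface `ψ`: it is tangent to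
`ℍ² × ℝ`, orthogonal to the surface and of length one. -/
structure IsUnitNormal (ψ η : S → L3R) : Prop where
  smooth : ContMDiff I 𝓘(ℝ, L3R) ∞ η
  tangent : ∀ q, lor (ψ q).1 (η q).1 = 0
  normal : ∀ q i, prodForm (partialAt I ψ q i) (η q) = 0
  unit : ∀ q, prodForm (η q) (η q) = 1

/-- The first fundamental form of `ψ` at `q`. -/
def firstForm (ψ : S → L3R) (q : S) : Matrix (Fin 2) (Fin 2) ℝ :=
  Matrix.of fun i j => prodForm (partialAt I ψ q i) (partialAt I ψ q j)

/-- The second fundamental form `⟨∇_X Y, η⟩ = -⟨∇_X η, Y⟩` of `ψ` at `q` with respect to `η`.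
The Levi-Civita connection of `ℍ² × ℝ` is the tangential part of the flat connection of `L³ × ℝ`
and `Y` is tangent to `ℍ² × ℝ`, so that `∇_X η` may be replaced by the flat derivative of `η`. -/
def secondForm (ψ η : S → L3R) (q : S) : Matrix (Fin 2) (Fin 2) ℝ :=
  Matrix.of fun i j => -prodForm (partialAt I η q i) (partialAt I ψ q j)

/-- The mean curvature (half of the sum of the principal curvatures) of `ψ` at `q` with respect to
the unit normal `η`. -/
def meanCurvature (ψ η : S → L3R) (q : S) : ℝ :=
  ((firstForm I ψ q)⁻¹ * secondForm I ψ η q).trace / 2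

/-- `ψ`, oriented by `η`, is a translating soliton of `ℍ² × ℝ`: its mean curvature equals its
angle function `⟨η, ∂_z⟩`. -/
structure IsOrientedSoliton (ψ η : S → L3R) : Prop where
  immersed : IsImmersedSurface I ψ
  unitNormal : IsUnitNormal I ψ η
  equation : ∀ q, meanCurvature I ψ η q = prodForm (η q) vert

/-- `ψ` is a translating soliton of `ℍ² × ℝ`: an orientable immersed surface whose mean curvature
equals its angle function. -/
def IsTranslatingSoliton (ψ : S → L3R) : Prop := ∃ η : S → L3R, IsOrientedSoliton I ψ η

end Surfaces

/-- The vertical graph of a function on `ℍ²`, where `ℍ²` is identified with the plane by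
`(x₁, x₂) ↦ (x₁, x₂, √(1 + x₁² + x₂²))`. -/
def graphMap (u : E2 → ℝ) (x : E2) : L3R :=
  (![x 0, x 1, √(1 + x 0 ^ 2 + x 1 ^ 2)], u x)

/-- `B` is the bowl soliton (whose height is determined up to a vertical translation): the entire,
upwards oriented vertical graph that is a translating soliton invariant under the rotations around
the vertical axis through the origin. -/
def IsBowlSoliton (B : Set L3R) : Prop :=
  ∃ u : E2 → ℝ, B = range (graphMap u) ∧ RotInvariant origin B ∧
    ∃ η : E2 → L3R, IsOrientedSoliton 𝓘(ℝ, E2) (graphMap u) η ∧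
      ∀ x, 0 < prodForm (η x) vert

/-- The closed solid vertical cylinder of radius `σ` around the vertical axis through the origin. -/
def solidCylinder (σ : ℝ) : Set L3R := {P | P ∈ H2R ∧ hdist origin P.1 ≤ σ}

/-- `Γ` is a closed embedded curve: the image of a topological embedding of the circle. -/
def IsClosedEmbeddedCurve (Γ : Set L3R) : Prop :=
  ∃ γ : Circle → L3R, IsEmbedding γ ∧ range γ = Γ

end

/-! The curve `Γ` is one circle around `l`, so height and distance to `l` are constant on the
boundary of `M`. Everything then follows from comparing `M` with a bowl around the same axis.

The bowl. With `t = sinh² r = ⟨x, c⟩² - 1`, the rotational graph `z = U t` is a soliton when `bowlOp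
t U' U'' = 0`. As `U` itself does not occur, the substitution `s = t / (1 + t) = tanh² r`, `y = (1 +
t) U'` leaves a first order equation for `y(s)`. It is singular on the axis `s = 0`, where a power
series solves it; the barriers `y = 0` and `y = 1` then carry the solution to all `s < 1`
(`exists_global_profile`), and the graph is entire.

Comparison. At a critical point of `z - φ(t)` on a soliton, the Hessian has trace `-2 * bowlOp /
β²`, with `|β|` the length of the ambient gradient (`gramTrace_restrictedHessian`). Since `bowlOp`
is strictly increasing in the slope (`bowlOp_perturb`), adding a small multiple of `t` to `U` makes
the equation a strict inequality, so the perturbed height has its extremum on the boundary. Letting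
the perturbation tend to zero, from both sides, shows that `z - U(t)` is constant on `M`
(`heightAbove_eq`): `M` lies on a vertical translate of the bowl.

Filling. On such a graph the projection to the plane is open at interior points, so the image of `M`
is compact and open off one circle. It is therefore the closed disc (`eq_closedBall_of_mem_nhds`),
and `M` is the whole piece above it. A boost taking `c` to the origin and a vertical shift place it
on the standard bowl. -/

noncomputable section

/-! ### The profile near the axis: a convergent power series -/

/-- A sequence can be defined by a recursion in which each term depends on all earlier ones. -/
lemma exists_seq_of_causal (x : ℝ) (G : ℕ → (ℕ → ℝ) → ℝ)
    (hG : ∀ n f g, (∀ k ≤ n, f k = g k) → G n f = G n g) :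
    ∃ a : ℕ → ℝ, a 0 = x ∧ ∀ n, a (n + 1) = G n a := by
  let A : ℕ → (ℕ → ℝ) := fun n => Nat.rec (fun _ => x)
    (fun n f => Function.update f (n + 1) (G n f)) n
  have hA : ∀ n, A (n + 1) = Function.update (A n) (n + 1) (G n (A n)) := fun n => rfl
  have hst : ∀ k d, A (k + d) k = A k k := by
    intro k d
    induction d with
    | zero => rfl
    | succ d ih =>
      rw [← add_assoc, hA, Function.update_of_ne (by omega), ih]
  refine ⟨fun n => A n n, rfl, fun n => ?_⟩
  change A (n + 1) (n + 1) = _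
  rw [hA, Function.update_self]
  refine hG n _ _ fun k hk => ?_
  obtain ⟨d, rfl⟩ := Nat.exists_eq_add_of_le hk
  exact hst k d

/-- The Cauchy product of two sequences. -/
def conv (f g : ℕ → ℝ) (n : ℕ) : ℝ := ∑ p ∈ Finset.HasAntidiagonal.antidiagonal n, f p.1 * g p.2

lemma conv_congr {f g f' g' : ℕ → ℝ} {n : ℕ} (hf : ∀ k ≤ n, f k = f' k)
    (hg : ∀ k ≤ n, g k = g' k) : conv f g n = conv f' g' n := by
  refine Finset.sum_congr rfl fun p hp => ?_
  rw [Finset.HasAntidiagonal.mem_antidiagonal] at hp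
  rw [hf _ (by omega), hg _ (by omega)]

lemma conv_nonneg {f g : ℕ → ℝ} (hf : ∀ k, 0 ≤ f k) (hg : ∀ k, 0 ≤ g k) (n : ℕ) :
    0 ≤ conv f g n :=
  Finset.sum_nonneg fun _ _ => mul_nonneg (hf _) (hg _)

lemma conv_mul_pow (f g : ℕ → ℝ) (r : ℝ) (n : ℕ) :
    conv f g n * r ^ n = conv (fun k => f k * r ^ k) (fun k => g k * r ^ k) n := by
  rw [conv, conv, Finset.sum_mul]
  refine Finset.sum_congr rfl fun p hp => ?_
  rw [Finset.HasAntidiagonal.mem_antidiagonal] at hp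
  rw [← hp, pow_add]
  ring

lemma abs_conv_le (f g : ℕ → ℝ) (n : ℕ) :
    |conv f g n| ≤ conv (fun k => |f k|) (fun k => |g k|) n := by
  refine (Finset.abs_sum_le_sum_abs _ _).trans (le_of_eq ?_)
  simp only [conv, abs_mul]

lemma conv_mono_left {f f' g : ℕ → ℝ} (hf : ∀ k, f k ≤ f' k) (hg : ∀ k, 0 ≤ g k) (n : ℕ) :
    conv f g n ≤ conv f' g n :=
  Finset.sum_le_sum fun _ _ => mul_le_mul_of_nonneg_right (hf _) (hg _)

/-- The index pairs on the left form the triangle `i + j < N`, which lies in the square on the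
right. -/
lemma sum_conv_le {f g : ℕ → ℝ} (hf : ∀ k, 0 ≤ f k) (hg : ∀ k, 0 ≤ g k) (N : ℕ) :
    ∑ n ∈ Finset.range N, conv f g n ≤
      (∑ n ∈ Finset.range N, f n) * ∑ n ∈ Finset.range N, g n := by
  rw [Finset.sum_mul_sum, ← Finset.sum_product']
  simp only [conv]
  rw [Finset.sum_sigma', ← Finset.sum_image (g := fun x : (_ : ℕ) × ℕ × ℕ => x.2)
    (f := fun p : ℕ × ℕ => f p.1 * g p.2)]
  · refine Finset.sum_le_sum_of_subset_of_nonneg ?_ fun p _ _ => mul_nonneg (hf _) (hg _)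
    intro p hp
    simp only [Finset.mem_image, Finset.mem_sigma, Finset.mem_range,
      Finset.HasAntidiagonal.mem_antidiagonal] at hp
    obtain ⟨x, ⟨hx, hx'⟩, rfl⟩ := hp
    simp only [Finset.mem_product, Finset.mem_range]
    omega
  · rintro ⟨m, p⟩ hm ⟨n, q⟩ hn (rfl : p = q)
    simp only [Finset.coe_sigma, Set.mem_sigma_iff, Finset.mem_coe,
      Finset.HasAntidiagonal.mem_antidiagonal] at hm hn
    obtain rfl := hm.2.symm.trans hn.2
    rfl

/-- The coefficients of the power series at `0` of the profile of the bowl soliton. -/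
lemma exists_bowl_coeff : ∃ a : ℕ → ℝ, a 0 = 1 / 2 ∧
    ∀ n : ℕ, (2 * n + 4) * a (n + 1) =
      (2 * n + 1) * a n + 4 * (conv a a n - conv (conv a a) a n) := by
  -- The equation reads `2sy' + 2y = 1 + s(2sy' + y + 4y² - 4y³)`. The constant term forces `a 0 =
  -- 1/2`, and the coefficient of `s^(n+1)` is the recursion.
  obtain ⟨a, h0, h⟩ := exists_seq_of_causal (1 / 2)
    (fun n a => ((2 * n + 1) * a n + 4 * (conv a a n - conv (conv a a) a n)) / (2 * n + 4)) (by
      intro n f g h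
      have h2 : ∀ k ≤ n, conv f f k = conv g g k := fun k hk =>
        conv_congr (fun j hj => h j (hj.trans hk)) (fun j hj => h j (hj.trans hk))
      simp only [h n le_rfl, h2 n le_rfl, conv_congr h2 h])
  refine ⟨a, h0, fun n => ?_⟩
  have : (2 * n + 4 : ℝ) ≠ 0 := by positivity
  rw [h n]
  field_simp

/-- The radius `1/6` is chosen so that the bound `1` on the partial sums `S` reproduces itself: the
next sum is at most `1/2 + (S + S² + S³)/6 ≤ 1`. -/
lemma summable_bowl_coeff {a : ℕ → ℝ} (h0 : a 0 = 1 / 2)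
    (h : ∀ n : ℕ, (2 * n + 4) * a (n + 1) =
      (2 * n + 1) * a n + 4 * (conv a a n - conv (conv a a) a n)) :
    Summable fun n => |a n| * (1 / 6 : ℝ) ^ n := by
  set b : ℕ → ℝ := fun n => |a n| * (1 / 6 : ℝ) ^ n with hb
  have hb0 : ∀ n, 0 ≤ b n := fun n => by positivity
  have hstep : ∀ n, b (n + 1) ≤ 1 / 6 * (b n + conv b b n + conv (conv b b) b n) := by
    intro n
    have hc2 := abs_conv_le a a n
    have hc3 := (abs_conv_le (conv a a) a n).trans
      (conv_mono_left (abs_conv_le a a) (fun k => abs_nonneg _) n)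
    have e2 : conv b b n = conv (fun k => |a k|) (fun k => |a k|) n * (1 / 6 : ℝ) ^ n :=
      (conv_mul_pow _ _ _ _).symm
    have e3 : conv (conv b b) b n =
        conv (conv (fun k => |a k|) (fun k => |a k|)) (fun k => |a k|) n * (1 / 6 : ℝ) ^ n := by
      rw [conv_mul_pow]
      congr 1
      funext k
      exact (conv_mul_pow _ _ _ _).symm
    have hn : (0 : ℝ) ≤ n := n.cast_nonneg
    have key : |a (n + 1)| ≤ |a n| + conv (fun k => |a k|) (fun k => |a k|) n +
        conv (conv (fun k => |a k|) (fun k => |a k|)) (fun k => |a k|) n := by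
      have h1 : (2 * n + 4 : ℝ) * |a (n + 1)| ≤
          (2 * n + 1) * |a n| + 4 * (|conv a a n| + |conv (conv a a) a n|) := by
        have : (2 * n + 4 : ℝ) * |a (n + 1)| = |(2 * n + 4 : ℝ) * a (n + 1)| := by
          rw [abs_mul, abs_of_nonneg (by positivity : (0 : ℝ) ≤ 2 * n + 4)]
        rw [this, h n]
        refine (abs_add_le _ _).trans ?_
        rw [abs_mul, abs_mul, abs_of_nonneg (by positivity : (0 : ℝ) ≤ 2 * n + 1),
          abs_of_nonneg (by norm_num : (0 : ℝ) ≤ 4)]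
        gcongr
        exact abs_sub _ _
      have p1 := abs_nonneg (a n)
      have p2 := (abs_nonneg _).trans hc2
      have p3 := (abs_nonneg _).trans hc3
      have : (2 * n + 4 : ℝ) * |a (n + 1)| ≤ (2 * n + 4) *
        (|a n| + conv (fun k => |a k|) (fun k => |a k|) n +
        conv (conv (fun k => |a k|) (fun k => |a k|)) (fun k => |a k|) n) := by
        nlinarith [mul_nonneg hn p2, mul_nonneg hn p3]
      exact le_of_mul_le_mul_left this (by positivity)
    rw [e2, e3]
    simp only [hb]
    rw [pow_succ]
    have hp : (0 : ℝ) < (1 / 6) ^ n := by positivity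
    nlinarith [mul_le_mul_of_nonneg_right key hp.le]
  have hS : ∀ N, ∑ n ∈ Finset.range N, b n ≤ 1 := by
    intro N
    induction N with
    | zero => simp
    | succ N ih =>
      set s := ∑ n ∈ Finset.range N, b n
      have s0 : 0 ≤ s := Finset.sum_nonneg fun n _ => hb0 n
      rw [Finset.sum_range_succ']
      have hcb := sum_conv_le hb0 hb0 N
      have hcb3 := sum_conv_le (conv_nonneg hb0 hb0) hb0 N
      have h1 : ∑ n ∈ Finset.range N, b (n + 1) ≤
          1 / 6 * (s + ∑ n ∈ Finset.range N, conv b b n +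
            ∑ n ∈ Finset.range N, conv (conv b b) b n) := by
        rw [← Finset.sum_add_distrib, ← Finset.sum_add_distrib, Finset.mul_sum]
        exact Finset.sum_le_sum fun n _ => hstep n
      have h2 : ∑ n ∈ Finset.range N, conv b b n ≤ 1 := by nlinarith
      have h2' : 0 ≤ ∑ n ∈ Finset.range N, conv b b n :=
        Finset.sum_nonneg fun n _ => conv_nonneg hb0 hb0 n
      have h3 : ∑ n ∈ Finset.range N, conv (conv b b) b n ≤ 1 := by
        refine hcb3.trans ?_
        nlinarith
      have h4 : b 0 = 1 / 2 := by simp [hb, h0]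
      linarith
  exact summable_of_sum_range_le hb0 hS

lemma summable_mul_pow_of_abs_le {a : ℕ → ℝ} {r s : ℝ} (hs : Summable fun n => |a n| * r ^ n)
    (h : |s| ≤ r) : Summable fun n => ‖a n * s ^ n‖ := by
  refine hs.of_nonneg_of_le (fun n => norm_nonneg _) fun n => ?_
  rw [norm_mul, norm_pow]
  exact mul_le_mul_of_nonneg_left (pow_le_pow_left₀ (norm_nonneg _) h n) (abs_nonneg _)

lemma contDiffAt_tsum_mul_pow {a : ℕ → ℝ} {r : ℝ} (hr : 0 < r)
    (hs : Summable fun n => |a n| * r ^ n) {s : ℝ} (h : |s| < r) :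
    ContDiffAt ℝ ∞ (fun s => ∑' n, a n * s ^ n) s := by
  lift r to NNReal using hr.le
  have hrad : (r : ENNReal) ≤ (FormalMultilinearSeries.ofScalars ℝ a).radius := by
    refine FormalMultilinearSeries.le_radius_of_summable_norm _ ?_
    simpa using hs
  have hpos : (0 : ENNReal) < r := by exact_mod_cast hr
  have h1 := (FormalMultilinearSeries.ofScalars ℝ a).hasFPowerSeriesOnBall (hpos.trans_le hrad)
  have h2 : AnalyticAt ℝ (FormalMultilinearSeries.ofScalars ℝ a).sum s := by
    refine h1.analyticAt_of_mem (Metric.eball_subset_eball hrad ?_)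
    rw [Metric.mem_eball, edist_zero_right, enorm_eq_nnnorm]
    rw [← Real.norm_eq_abs] at h
    exact_mod_cast h
  have h3 : (FormalMultilinearSeries.ofScalars ℝ a).sum = fun s => ∑' n, a n * s ^ n := by
    have := FormalMultilinearSeries.ofScalarsSum_eq_tsum (E := ℝ) a
    simpa [FormalMultilinearSeries.ofScalarsSum] using this
  rw [← h3]
  exact h2.contDiffAt

/-- Only `s * y'` enters the bowl equation, and its series keeps the exponent `n`, with no shift of
indices. -/
lemma hasDerivAt_tsum_mul_pow {a : ℕ → ℝ} {r : ℝ} (hr : 0 < r)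
    (hs : Summable fun n => |a n| * r ^ n) {s : ℝ} (h : |s| < r) :
    (Summable fun n : ℕ => (n : ℝ) * a n * s ^ n) ∧
    ∃ y', HasDerivAt (fun s : ℝ => ∑' n : ℕ, a n * s ^ n) y' s ∧
      s * y' = ∑' n : ℕ, (n : ℝ) * a n * s ^ n := by
  obtain ⟨ρ, h1, h2⟩ := exists_between h
  have hρ : 0 < ρ := (abs_nonneg s).trans_lt h1
  have hu : Summable fun n : ℕ => (n : ℝ) * |a n| * ρ ^ (n - 1) := by
    -- Between `ρ` and `r` there is room for a geometric factor, which absorbs the factor `n` from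
    -- differentiation.
    have hb : ∃ C, ∀ n : ℕ, (n : ℝ) * (ρ / r) ^ n ≤ C := by
      have := tendsto_self_mul_const_pow_of_lt_one (r := ρ / r) (by positivity)
        ((div_lt_one hr).2 h2)
      obtain ⟨C, hC⟩ := this.bddAbove_range
      exact ⟨C, fun n => hC ⟨n, rfl⟩⟩
    obtain ⟨C, hC⟩ := hb
    refine (hs.mul_left (C / ρ)).of_nonneg_of_le (fun n => by positivity) fun n => ?_
    rcases n with _ | n
    · have := hC 0
      simp at this
      simp
      positivity
    · have h3 := hC (n + 1)
      have : ((n + 1 : ℕ) : ℝ) * ρ ^ (n + 1) ≤ C * r ^ (n + 1) := by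
        rw [div_pow, ← mul_div_assoc, div_le_iff₀ (by positivity)] at h3
        exact h3
      rw [Nat.add_sub_cancel]
      have e : ((n + 1 : ℕ) : ℝ) * |a (n + 1)| * ρ ^ n =
          |a (n + 1)| / ρ * (((n + 1 : ℕ) : ℝ) * ρ ^ (n + 1)) := by
        field_simp
        ring
      have e' : C / ρ * (|a (n + 1)| * r ^ (n + 1)) = |a (n + 1)| / ρ * (C * r ^ (n + 1)) := by
        field_simp
      rw [e, e']
      gcongr
  have hbd : ∀ (n : ℕ) (y : ℝ), |y| < ρ → ‖a n * (n * y ^ (n - 1))‖ ≤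
      (n : ℝ) * |a n| * ρ ^ (n - 1) := by
    intro n y hy
    rw [norm_mul, norm_mul, norm_pow, Real.norm_natCast, Real.norm_eq_abs, Real.norm_eq_abs]
    have := pow_le_pow_left₀ (abs_nonneg y) hy.le (n - 1)
    calc |a n| * (n * |y| ^ (n - 1)) = n * |a n| * |y| ^ (n - 1) := by ring
      _ ≤ _ := by gcongr
  have hd := hasDerivAt_tsum_of_isPreconnected (g := fun (n : ℕ) (s : ℝ) => a n * s ^ n)
    (g' := fun (n : ℕ) (s : ℝ) => a n * (n * s ^ (n - 1))) (t := Metric.ball 0 ρ) (y₀ := 0) (y := s) hu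
    Metric.isOpen_ball (convex_ball _ _).isPreconnected
    (fun n y _ => (hasDerivAt_pow n y).const_mul (a n))
    (fun n y hy => hbd n y (by simpa using hy)) (Metric.mem_ball_self hρ)
    (summable_mul_pow_of_abs_le hs (by simpa using hr.le)).of_norm (by simpa using h1)
  have hsm : Summable fun n : ℕ => a n * (n * s ^ (n - 1)) :=
    Summable.of_norm_bounded hu fun n => hbd n s h1
  have e : ∀ n : ℕ, s * (a n * (n * s ^ (n - 1))) = (n : ℝ) * a n * s ^ n := by
    rintro (_ | n)
    · simp
    · rw [Nat.add_sub_cancel, pow_succ]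
      ring
  refine ⟨?_, _, hd, ?_⟩
  · simpa only [e] using hsm.mul_left s
  · rw [← tsum_mul_left]
    simp only [e]

lemma tsum_conv_mul_pow {f g : ℕ → ℝ} {s : ℝ} (hf : Summable fun n => ‖f n * s ^ n‖)
    (hg : Summable fun n => ‖g n * s ^ n‖) :
    (Summable fun n => ‖conv f g n * s ^ n‖) ∧
    ∑' n, conv f g n * s ^ n = (∑' n, f n * s ^ n) * ∑' n, g n * s ^ n := by
  have h1 := summable_norm_sum_mul_antidiagonal_of_summable_norm hf hg
  have h2 := tsum_mul_tsum_eq_tsum_sum_antidiagonal_of_summable_norm hf hg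
  have e : ∀ n, conv f g n * s ^ n = ∑ p ∈ Finset.HasAntidiagonal.antidiagonal n,
      f p.1 * s ^ p.1 * (g p.2 * s ^ p.2) := fun n => conv_mul_pow f g s n
  simp only [e]
  exact ⟨h1, h2.symm⟩

/-- The bowl equation has a smooth solution near the rotation axis. -/
lemma exists_local_profile : ∃ y : ℝ → ℝ, y 0 = 1 / 2 ∧
    ∀ s, |s| < 1 / 6 → ContDiffAt ℝ ∞ y s ∧
      2 * s * (1 - s) * deriv y s = (1 - y s) * (1 + 4 * y s ^ 2 * s) - y s * (1 - s) := by
  obtain ⟨a, h0, h⟩ := exists_bowl_coeff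
  have hs := summable_bowl_coeff h0 h
  refine ⟨fun s => ∑' n, a n * s ^ n, ?_, fun s hs6 =>
    ⟨contDiffAt_tsum_mul_pow (by norm_num) hs hs6, ?_⟩⟩
  · change ∑' n, a n * (0 : ℝ) ^ n = 1 / 2
    rw [tsum_eq_single 0 (fun n hn => by simp [hn])]
    simp [h0]
  obtain ⟨hn, y', hy', he⟩ := hasDerivAt_tsum_mul_pow (by norm_num) hs hs6
  have h1 := summable_mul_pow_of_abs_le hs hs6.le
  obtain ⟨h2, e2⟩ := tsum_conv_mul_pow h1 h1
  obtain ⟨h3, e3⟩ := tsum_conv_mul_pow h2 h1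
  rw [hy'.deriv]
  set y := ∑' n, a n * s ^ n with hy
  -- `L` and `R` sum the left side and the bracket of `2sy' + 2y = 1 + s(2sy' + y + 4y² - 4y³)`; the
  -- recursion identifies the tail of `L` with `s` times `R`.
  have L : ∑' n : ℕ, (2 * ((n : ℝ) * a n * s ^ n) + 2 * (a n * s ^ n)) = 2 * (s * y') + 2 * y := by
    rw [Summable.tsum_add (hn.mul_left 2) (h1.of_norm.mul_left 2), tsum_mul_left, tsum_mul_left, he]
  have R : ∑' n : ℕ, (2 * ((n : ℝ) * a n * s ^ n) + (a n * s ^ n) +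
      4 * (conv a a n * s ^ n - conv (conv a a) a n * s ^ n)) =
      2 * (s * y') + y + 4 * (y * y - y * y * y) := by
    rw [Summable.tsum_add ((hn.mul_left 2).add h1.of_norm)
      ((h2.of_norm.sub h3.of_norm).mul_left 4),
      Summable.tsum_add (hn.mul_left 2) h1.of_norm, tsum_mul_left, tsum_mul_left,
      Summable.tsum_sub h2.of_norm h3.of_norm, e3, e2, he]
  rw [Summable.tsum_eq_zero_add ((hn.mul_left 2).add (h1.of_norm.mul_left 2))] at L
  have S : ∀ n : ℕ, 2 * (((n + 1 : ℕ) : ℝ) * a (n + 1) * s ^ (n + 1)) +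
      2 * (a (n + 1) * s ^ (n + 1)) =
      s * (2 * ((n : ℝ) * a n * s ^ n) + (a n * s ^ n) +
      4 * (conv a a n * s ^ n - conv (conv a a) a n * s ^ n)) := by
    intro n
    have := h n
    rw [pow_succ]
    push_cast
    linear_combination s ^ n * s * this
  simp only [S] at L
  rw [tsum_mul_left, R, h0] at L
  simp only [pow_zero, Nat.cast_zero] at L
  change 2 * s * (1 - s) * y' = (1 - y) * (1 + 4 * y ^ 2 * s) - y * (1 - s)
  linear_combination -L

/-! ### Continuation of the profile to all radii -/

/-- The slope field of the bowl equation, in the variable `s = tanh² r`. -/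
def bowlField (s y : ℝ) : ℝ :=
  ((1 - y) * (1 + 4 * y ^ 2 * s) - y * (1 - s)) / (2 * s * (1 - s))

/-- Together with `bowlField_one_neg` this makes the strip `0 ≤ y ≤ 1` forward invariant, which
excludes blow-up before `s = 1`. -/
lemma bowlField_zero_pos {s : ℝ} (h0 : 0 < s) (h1 : s < 1) : 0 < bowlField s 0 := by
  have : 0 < 1 - s := by linarith
  simp only [bowlField]
  norm_num
  positivity

lemma bowlField_one_neg {s : ℝ} (h0 : 0 < s) (h1 : s < 1) : bowlField s 1 < 0 := by
  have : 0 < 1 - s := by linarith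
  refine div_neg_of_neg_of_pos ?_ (by positivity)
  linarith

lemma contDiffOn_bowlField {a b : ℝ} (ha : 0 < a) (hb : b < 1) (u : Set ℝ) :
    ContDiffOn ℝ ∞ (Function.uncurry bowlField) (Icc a b ×ˢ u) := by
  refine ContDiffOn.div (by fun_prop) (by fun_prop) ?_
  rintro ⟨s, y⟩ ⟨⟨hs1, hs2⟩, -⟩
  have h1 : 0 < s := ha.trans_le hs1
  have h2 : 0 < 1 - s := by linarith [hs2]
  positivity

lemma bowlField_lipschitz {a b : ℝ} (ha : 0 < a) (hb : b < 1) :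
    ∃ K : NNReal, ∀ s ∈ Icc a b, LipschitzOnWith K (bowlField s) (Icc 0 1) := by
  have hb' : 0 < 1 - b := by linarith
  have hden : 0 < 2 * a * (1 - b) := by positivity
  -- The number `20` is a crude bound for the numerator of the difference quotient on the strip, and
  -- `2a(1 - b)` bounds its denominator from below.
  refine ⟨Real.toNNReal (20 / (2 * a * (1 - b))), fun s hs => ?_⟩
  have h1 : 0 < s := ha.trans_le hs.1
  have h2 : 0 < 1 - s := by linarith [hs.2]
  refine LipschitzOnWith.of_dist_le_mul fun x hx y hy => ?_
  rw [Real.dist_eq, Real.dist_eq, Real.coe_toNNReal _ (by positivity)]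
  have e : bowlField s x - bowlField s y = (x - y) *
      ((-2 + s + 4 * s * (x + y) - 4 * s * (x ^ 2 + x * y + y ^ 2)) / (2 * s * (1 - s))) := by
    simp only [bowlField]
    field_simp
    ring
  rw [e, abs_mul, mul_comm, abs_div, abs_of_pos (by positivity : 0 < 2 * s * (1 - s))]
  refine mul_le_mul_of_nonneg_right ?_ (abs_nonneg _)
  obtain ⟨hx0, hx1⟩ := hx
  obtain ⟨hy0, hy1⟩ := hy
  have hq : 0 ≤ x ^ 2 + x * y + y ^ 2 := by positivity
  have hq' : x ^ 2 + x * y + y ^ 2 ≤ 3 := by nlinarith [mul_nonneg hx0 hy0]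
  have hs1 : s ≤ 1 := by linarith
  gcongr ?_ / ?_
  · rw [abs_le]
    constructor
    · nlinarith [mul_nonneg h1.le (add_nonneg hx0 hy0), mul_le_mul hs1 hq' hq zero_le_one]
    · nlinarith [mul_nonneg h1.le hq, mul_le_mul hs1 (add_le_add hx1 hy1) (add_nonneg hx0 hy0)
        zero_le_one]
  · have := mul_le_mul hs.1 (by linarith [hs.2] : 1 - b ≤ 1 - s) hb'.le h1.le
    nlinarith

/-- A scalar equation whose slope field points into the strip `0 ≤ y ≤ 1` has a solution on the
whole time interval. -/
lemma exists_solution_in_strip {f : ℝ → ℝ → ℝ} {a b : ℝ} (hab : a ≤ b)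
    (hf : ContinuousOn (Function.uncurry f) (Icc a b ×ˢ Icc 0 1)) {K : NNReal}
    (hK : ∀ s ∈ Icc a b, LipschitzOnWith K (f s) (Icc 0 1))
    (h0 : ∀ s ∈ Icc a b, 0 < f s 0) (h1 : ∀ s ∈ Icc a b, f s 1 < 0) {y₀ : ℝ}
    (hy₀ : y₀ ∈ Icc (0 : ℝ) 1) :
    ∃ y : ℝ → ℝ, y a = y₀ ∧ ∀ s ∈ Icc a b,
      HasDerivWithinAt y (f s (y s)) (Icc a b) s ∧ y s ∈ Icc (0 : ℝ) 1 := by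
  -- Clamping `y` to `[0, 1]` makes the field bounded and globally Lipschitz, so Picard–Lindelöf
  -- covers the whole interval at once. The barriers then show that the solution never leaves the
  -- strip, where the clamp is the identity.
  set c : ℝ → ℝ := fun y => projIcc 0 1 zero_le_one y with hc
  have hcm : ∀ y, c y ∈ Icc (0 : ℝ) 1 := fun y => (projIcc 0 1 zero_le_one y).2
  have hcl : LipschitzWith 1 c := LipschitzWith.projIcc zero_le_one
  have hcs : ∀ y ∈ Icc (0 : ℝ) 1, c y = y := fun y hy => by simp [hc, projIcc_of_mem _ hy]
  obtain ⟨C, hC⟩ := (isCompact_Icc.prod isCompact_Icc).exists_bound_of_continuousOn hf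
  have hC' : ∀ s ∈ Icc a b, ∀ y, ‖f s (c y)‖ ≤ max C 0 := fun s hs y =>
    (hC (s, c y) ⟨hs, hcm y⟩).trans (le_max_left _ _)
  set L : NNReal := Real.toNNReal (max C 0) with hL
  have hLC : (L : ℝ) = max C 0 := Real.coe_toNNReal _ (le_max_right _ _)
  have hP : IsPicardLindelof (fun s y => f s (c y)) (⟨a, left_mem_Icc.2 hab⟩ : Icc a b) y₀
      (L * Real.toNNReal (b - a)) 0 L K := by
    refine ⟨fun s hs => ?_, fun y _ => ?_, fun s hs y _ => (hC' s hs y).trans_eq hLC.symm, ?_⟩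
    · have := (hK s hs).comp (hcl.lipschitzOnWith (s := univ)) (fun y _ => hcm y)
      rw [mul_one] at this
      exact this.mono (subset_univ _)
    · exact hf.comp (f := fun s => (s, c y)) (s := Icc a b) (by fun_prop)
        fun s hs => ⟨hs, hcm y⟩
    · simp [hab, Real.coe_toNNReal _ (sub_nonneg.2 hab)]
  obtain ⟨y, hya, hy⟩ := hP.exists_eq_forall_mem_Icc_hasDerivWithinAt₀
  have hcont : ContinuousOn y (Icc a b) := fun s hs => (hy s hs).continuousWithinAt
  have hder : ∀ s ∈ Ico a b, HasDerivWithinAt y (f s (c (y s))) (Ici s) s := fun s hs =>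
    (hy s (Ico_subset_Icc_self hs)).mono_of_mem_nhdsWithin
      (Filter.mem_of_superset (Icc_mem_nhdsGE hs.2) (Icc_subset_Icc_left hs.1))
  have hle : ∀ s ∈ Icc a b, y s ≤ 1 := by
    refine image_le_of_deriv_right_lt_deriv_boundary hcont hder (B := fun _ => 1)
      (B' := fun _ => 0) (by simpa [hya] using hy₀.2) (fun s => hasDerivAt_const _ _) ?_
    intro s hs he
    rw [he, hcs 1 (by simp)]
    exact h1 s (Ico_subset_Icc_self hs)
  have hge : ∀ s ∈ Icc a b, -y s ≤ 0 := by
    refine image_le_of_deriv_right_lt_deriv_boundary hcont.neg (fun s hs => (hder s hs).neg)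
      (B := fun _ => 0) (B' := fun _ => 0) (by simpa [hya] using hy₀.1)
      (fun s => hasDerivAt_const _ _) ?_
    intro s hs he
    have he : y s = 0 := by simpa using he
    rw [he, hcs 0 (by simp)]
    simpa using h0 s (Ico_subset_Icc_self hs)
  refine ⟨y, hya, fun s hs => ?_⟩
  have hm : y s ∈ Icc (0 : ℝ) 1 := ⟨by linarith [hge s hs], hle s hs⟩
  have := hy s hs
  rw [hcs _ hm] at this
  exact ⟨this, hm⟩

/-- `y` is a solution of the bowl equation on `[a, b]` with values in `[0, 1]`. -/
def IsBowlSolution (a b : ℝ) (y : ℝ → ℝ) : Prop :=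
  ∀ s ∈ Icc a b, HasDerivWithinAt y (bowlField s (y s)) (Icc a b) s ∧ y s ∈ Icc (0 : ℝ) 1

lemma IsBowlSolution.mono {a b b' : ℝ} {y : ℝ → ℝ} (h : IsBowlSolution a b y) (hb : b' ≤ b) :
    IsBowlSolution a b' y := fun s hs =>
  have hs' := Icc_subset_Icc_right hb hs
  ⟨(h s hs').1.mono (Icc_subset_Icc_right hb), (h s hs').2⟩

lemma IsBowlSolution.eqOn {a b : ℝ} (ha : 0 < a) (hb : b < 1) {y z : ℝ → ℝ}
    (hy : IsBowlSolution a b y) (hz : IsBowlSolution a b z) (h : y a = z a) :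
    EqOn y z (Icc a b) := by
  obtain ⟨K, hK⟩ := bowlField_lipschitz ha hb
  have key : ∀ w, IsBowlSolution a b w → ContinuousOn w (Icc a b) ∧
      ∀ s ∈ Ico a b, HasDerivWithinAt w (bowlField s (w s)) (Ici s) s := fun w hw =>
    ⟨fun s hs => (hw s hs).1.continuousWithinAt, fun s hs =>
      (hw s (Ico_subset_Icc_self hs)).1.mono_of_mem_nhdsWithin
        (Filter.mem_of_superset (Icc_mem_nhdsGE hs.2) (Icc_subset_Icc_left hs.1))⟩
  exact ODE_solution_unique_of_mem_Icc_right (s := fun _ => Icc 0 1)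
    (fun s hs => hK s (Ico_subset_Icc_self hs)) (key y hy).1 (key y hy).2
    (fun s hs => (hy s (Ico_subset_Icc_self hs)).2) (key z hz).1 (key z hz).2
    (fun s hs => (hz s (Ico_subset_Icc_self hs)).2) h

lemma IsBowlSolution.contDiffAt {a b : ℝ} (ha : 0 < a) (hb : b < 1) {y : ℝ → ℝ}
    (hy : IsBowlSolution a b y) {s : ℝ} (hs : s ∈ Ioo a b) : ContDiffAt ℝ ∞ y s :=
  (ODE.contDiffOn_enat_Icc_of_hasDerivWithinAt (n := ⊤) (u := Icc 0 1)
    (contDiffOn_bowlField ha hb _) (fun s hs => (hy s hs).1) (fun s hs => (hy s hs).2)).contDiffAt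
    (Icc_mem_nhds hs.1 hs.2)

lemma bowlField_eq_iff {s y d : ℝ} (h0 : s ≠ 0) (h1 : s ≠ 1) : d = bowlField s y ↔
    2 * s * (1 - s) * d = (1 - y) * (1 + 4 * y ^ 2 * s) - y * (1 - s) := by
  have : 1 - s ≠ 0 := sub_ne_zero.2 h1.symm
  rw [bowlField, eq_div_iff (by positivity), mul_comm]

/-- The bowl equation has a solution that is smooth for all `-1/6 < s < 1`. -/
lemma exists_global_profile : ∃ y : ℝ → ℝ, ∀ s, -(1 / 6) < s → s < 1 → ContDiffAt ℝ ∞ y s ∧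
    2 * s * (1 - s) * deriv y s = (1 - y s) * (1 + 4 * y s ^ 2 * s) - y s * (1 - s) := by
  obtain ⟨z, hz0, hz⟩ := exists_local_profile
  obtain ⟨b, hb0, hb6, hb⟩ : ∃ b > 0, b < 1 / 6 ∧ ∀ s, |s| ≤ b → z s ∈ Icc (0 : ℝ) 1 := by
    have hc : ContinuousAt z 0 := (hz 0 (by norm_num)).1.continuousAt
    have := hc.preimage_mem_nhds (Icc_mem_nhds (a := 0) (b := 1) (by norm_num [hz0])
      (by norm_num [hz0]))
    obtain ⟨δ, hδ, h⟩ := Metric.mem_nhds_iff.1 this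
    refine ⟨min (δ / 2) (1 / 7), by positivity, (min_le_right _ _).trans_lt (by norm_num),
      fun s hs => h ?_⟩
    rw [Metric.mem_ball, Real.dist_0_eq_abs]
    exact (hs.trans (min_le_left _ _)).trans_lt (by linarith)
  -- The continuation starts at `a`, inside the range of the series solution, so that the two
  -- overlap on `[a, b]` and glue smoothly.
  set a := b / 2 with ha
  have ha0 : 0 < a := by positivity
  have hzs : IsBowlSolution a b z := by
    intro s hs
    have h0 : 0 < s := ha0.trans_le hs.1
    have hs6 : |s| < 1 / 6 := by rw [abs_of_pos h0]; linarith [hs.2]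
    refine ⟨?_, hb s (by rw [abs_of_pos h0]; exact hs.2)⟩
    rw [← (bowlField_eq_iff h0.ne' (by linarith [hs.2])).2 (hz s hs6).2]
    exact ((hz s hs6).1.differentiableAt (by simp)).hasDerivAt.hasDerivWithinAt
  -- The conditions on `T` sit behind the existential, with a dummy solution otherwise, so that
  -- `choose` yields a family indexed by all `T`.
  have hex : ∀ T, ∃ w, a ≤ T → T < 1 → w a = z a ∧ IsBowlSolution a T w := by
    intro T
    by_cases hT : a ≤ T ∧ T < 1
    · obtain ⟨K, hK⟩ := bowlField_lipschitz ha0 hT.2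
      obtain ⟨w, hw, hw'⟩ := exists_solution_in_strip hT.1
        (contDiffOn_bowlField ha0 hT.2 _).continuousOn hK
        (fun s hs => bowlField_zero_pos (ha0.trans_le hs.1) (hs.2.trans_lt hT.2))
        (fun s hs => bowlField_one_neg (ha0.trans_le hs.1) (hs.2.trans_lt hT.2))
        (hb a (by rw [abs_of_pos ha0]; linarith))
      exact ⟨w, fun _ _ => ⟨hw, hw'⟩⟩
    · exact ⟨0, fun h1 h2 => absurd ⟨h1, h2⟩ hT⟩
  choose w hw using hex
  have hcmp : ∀ T T', a ≤ T → T ≤ T' → T' < 1 → EqOn (w T) (w T') (Icc a T) := by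
    intro T T' h1 h2 h3
    have hT := hw T h1 (h2.trans_lt h3)
    have hT' := hw T' (h1.trans h2) h3
    exact hT.2.eqOn ha0 (h2.trans_lt h3) (hT'.2.mono h2) (hT.1.trans hT'.1.symm)
  -- For `b ≤ s < 1` the horizon `(1 + s) / 2` lies strictly between `s` and `1`, so `s` is interior
  -- to the interval of the chosen solution.
  set y : ℝ → ℝ := fun s => if s < b then z s else w ((1 + s) / 2) s with hy
  have hyw : ∀ T, b ≤ T → T < 1 → EqOn y (w T) (Ioo a T) := by
    intro T h1 h2 s hs
    by_cases hsb : s < b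
    · simp only [hy, if_pos hsb]
      have hwT := hw T (by linarith) h2
      exact hzs.eqOn ha0 (by linarith) (hwT.2.mono h1) hwT.1.symm ⟨hs.1.le, hsb.le⟩
    · simp only [hy, if_neg hsb]
      rcases le_total ((1 + s) / 2) T with h | h
      · exact hcmp _ _ (by linarith [hs.1, hs.2]) h h2 ⟨hs.1.le, by linarith [hs.2]⟩
      · exact (hcmp _ _ (by linarith) h (by linarith [hs.2]) ⟨hs.1.le, hs.2.le⟩).symm
  refine ⟨y, fun s hs0 hs1 => ?_⟩
  rcases lt_or_ge s b with hsb | hsb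
  · have he : y =ᶠ[𝓝 s] z := by
      filter_upwards [Iio_mem_nhds hsb] with x hx
      simp only [hy, if_pos (mem_Iio.1 hx)]
    have := hz s (abs_lt.2 ⟨hs0, by linarith⟩)
    rw [he.deriv_eq, he.eq_of_nhds]
    exact ⟨this.1.congr_of_eventuallyEq he, this.2⟩
  · set T := (1 + s) / 2 with hT
    have hsT : s ∈ Ioo a T := ⟨by linarith, by linarith⟩
    have he : y =ᶠ[𝓝 s] w T :=
      (hyw T (by linarith) (by linarith)).eventuallyEq_of_mem (Ioo_mem_nhds hsT.1 hsT.2)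
    have hwT := (hw T (by linarith) (by linarith)).2
    rw [he.deriv_eq, he.eq_of_nhds]
    refine ⟨(hwT.contDiffAt ha0 (by linarith) hsT).congr_of_eventuallyEq he, ?_⟩
    have hd := (hwT s ⟨hsT.1.le, hsT.2.le⟩).1.hasDerivAt (Icc_mem_nhds hsT.1 hsT.2)
    exact (bowlField_eq_iff (by linarith [hsT.1]) (by linarith)).1 hd.deriv

/-- The profile of the bowl soliton, as a function of `t = sinh² r`. -/
lemma exists_bowl_profile : ∃ U : ℝ → ℝ, ∀ t, 0 ≤ t → ContDiffAt ℝ ∞ U t ∧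
    2 * t * (1 + t) * deriv (deriv U) t + (2 + 3 * t) * deriv U t +
      4 * t * (1 + t) ^ 2 * deriv U t ^ 3 - 1 - 4 * t * (1 + t) * deriv U t ^ 2 = 0 := by
  obtain ⟨y, hy⟩ := exists_global_profile
  -- This is `U'`, recovered from `y = (1 + t) U'` and `s = t / (1 + t)`.
  set p : ℝ → ℝ := fun t => y (t / (1 + t)) / (1 + t) with hp
  -- The map `t ↦ t / (1 + t)` sends `-1/7` to `-1/6`. The margin below `0` gives two-sided
  -- smoothness at `t = 0`, hence a smooth graph across the axis.
  set D : Set ℝ := Ioi (-(1 / 7)) with hD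
  have hDo : IsOpen D := isOpen_Ioi
  have hs : ∀ t ∈ D, 0 < 1 + t ∧ -(1 / 6) < t / (1 + t) ∧ t / (1 + t) < 1 := by
    intro t ht
    have h1 : -(1 / 7) < t := ht
    have h2 : 0 < 1 + t := by linarith
    exact ⟨h2, by rw [lt_div_iff₀ h2]; linarith, by rw [div_lt_one h2]; linarith⟩
  have hpc : ContDiffOn ℝ ∞ p D := by
    intro t ht
    obtain ⟨h1, h2, h3⟩ := hs t ht
    refine ContDiffAt.contDiffWithinAt ?_
    have hin : ContDiffAt ℝ ∞ (fun t : ℝ => t / (1 + t)) t :=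
      contDiffAt_id.div (contDiffAt_const.add contDiffAt_id) h1.ne'
    exact ((hy _ h2 h3).1.comp t hin).div (contDiffAt_const.add contDiffAt_id) h1.ne'
  set U : ℝ → ℝ := fun t => ∫ x in (0 : ℝ)..t, p x with hU
  have h0 : (0 : ℝ) ∈ D := by simp [hD]
  have hUd : ∀ t ∈ D, HasDerivAt U (p t) t := by
    intro t ht
    refine intervalIntegral.integral_hasDerivAt_right ?_
      (hpc.continuousOn.stronglyMeasurableAtFilter hDo t ht)
      (hpc.continuousOn.continuousAt (hDo.mem_nhds ht))
    refine (hpc.continuousOn.mono ?_).intervalIntegrable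
    exact (ordConnected_Ioi.uIcc_subset h0 ht)
  have hdU : ∀ t ∈ D, deriv U t = p t := fun t ht => (hUd t ht).deriv
  have hUc : ContDiffOn ℝ ∞ U D := by
    rw [contDiffOn_infty_iff_deriv_of_isOpen hDo]
    exact ⟨fun t ht => (hUd t ht).differentiableAt.differentiableWithinAt, hpc.congr hdU⟩
  refine ⟨U, fun t ht0 => ?_⟩
  have ht : t ∈ D := (by norm_num : -(1 / 7 : ℝ) < 0).trans_le ht0
  refine ⟨hUc.contDiffAt (hDo.mem_nhds ht), ?_⟩
  have e2 : deriv U =ᶠ[𝓝 t] p := Filter.eventuallyEq_of_mem (hDo.mem_nhds ht) hdU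
  rw [e2.deriv_eq, hdU t ht]
  obtain ⟨h1, h2, h3⟩ := hs t ht
  obtain ⟨hy1, hy2⟩ := hy _ h2 h3
  have hin : HasDerivAt (fun t : ℝ => t / (1 + t)) (1 / (1 + t) ^ 2) t := by
    refine ((hasDerivAt_id t).div ((hasDerivAt_id t).const_add 1) h1.ne').congr_deriv ?_
    simp
  have hpd : HasDerivAt p _ t :=
    (((hy1.differentiableAt (by simp)).hasDerivAt.comp t hin).div
      ((hasDerivAt_id t).const_add 1) h1.ne')
  rw [hpd.deriv]
  simp only [hp, Function.comp]
  set Y := y (t / (1 + t))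
  set Y' := deriv y (t / (1 + t))
  have h1' := h1.ne'
  have e1 : 1 - t / (1 + t) = 1 / (1 + t) := by field_simp; ring
  rw [e1] at hy2
  field_simp at hy2 ⊢
  linear_combination hy2

/-! ### Linear algebra of tangent frames and traces -/

lemma lor_comm (x y : L3) : lor x y = lor y x := by simp only [lor]; ring

lemma lor_add_left (x y z : L3) : lor (x + y) z = lor x z + lor y z := by
  simp only [lor, Pi.add_apply]; ring

lemma lor_smul_left (a : ℝ) (x y : L3) : lor (a • x) y = a * lor x y := by
  simp only [lor, Pi.smul_apply, smul_eq_mul]; ring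

lemma lor_add_right (x y z : L3) : lor x (y + z) = lor x y + lor x z := by
  simp only [lor, Pi.add_apply]; ring

lemma lor_smul_right (a : ℝ) (x y : L3) : lor x (a • y) = a * lor x y := by
  simp only [lor, Pi.smul_apply, smul_eq_mul]; ring

lemma lor_sub_left (x y z : L3) : lor (x - y) z = lor x z - lor y z := by
  simp only [lor, Pi.sub_apply]; ring

lemma lor_sub_right (x y z : L3) : lor x (y - z) = lor x y - lor x z := by
  simp only [lor, Pi.sub_apply]; ring

lemma prodForm_comm (V W : L3R) : prodForm V W = prodForm W V := by
  simp only [prodForm, lor]; ring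

lemma prodForm_add_left (U V W : L3R) : prodForm (U + V) W = prodForm U W + prodForm V W := by
  simp only [prodForm, Prod.fst_add, Prod.snd_add, lor_add_left]; ring

lemma prodForm_smul_left (a : ℝ) (V W : L3R) : prodForm (a • V) W = a * prodForm V W := by
  simp only [prodForm, Prod.smul_fst, Prod.smul_snd, lor_smul_left, smul_eq_mul]; ring

lemma prodForm_add_right (U V W : L3R) : prodForm U (V + W) = prodForm U V + prodForm U W := by
  rw [prodForm_comm, prodForm_add_left, prodForm_comm V, prodForm_comm W]

lemma prodForm_smul_right (a : ℝ) (V W : L3R) : prodForm V (a • W) = a * prodForm V W := by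
  rw [prodForm_comm, prodForm_smul_left, prodForm_comm]

/-- The Lorentz form is positive definite on the tangent planes of the hyperbolic plane. -/
lemma lor_self_pos {X v : L3} (hX : lor X X = -1) (h : lor X v = 0) (hv : v ≠ 0) :
    0 < lor v v := by
  simp only [lor] at *
  have h2 : 0 < X 2 ^ 2 := by nlinarith [sq_nonneg (X 0), sq_nonneg (X 1)]
  -- Tangency eliminates `v 2` and the hyperboloid equation eliminates `X 2 ^ 2`, leaving a sum of
  -- squares.
  have e : X 2 ^ 2 * (v 0 * v 0 + v 1 * v 1 - v 2 * v 2) =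
      v 0 ^ 2 + v 1 ^ 2 + (X 0 * v 1 - X 1 * v 0) ^ 2 := by
    linear_combination (-(v 0 ^ 2) - v 1 ^ 2) * hX +
      (X 0 * v 0 + X 1 * v 1 + X 2 * v 2) * h
  by_contra hc
  have hle : v 0 ^ 2 + v 1 ^ 2 + (X 0 * v 1 - X 1 * v 0) ^ 2 ≤ 0 := by
    rw [← e]
    exact mul_nonpos_of_nonneg_of_nonpos h2.le (not_lt.1 hc)
  have h0 : v 0 = 0 := by
    have : v 0 ^ 2 ≤ 0 := by nlinarith [sq_nonneg (v 1), sq_nonneg (X 0 * v 1 - X 1 * v 0)]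
    exact pow_eq_zero_iff two_ne_zero |>.1 (le_antisymm this (sq_nonneg _))
  have h1 : v 1 = 0 := by
    have : v 1 ^ 2 ≤ 0 := by nlinarith [sq_nonneg (v 0), sq_nonneg (X 0 * v 1 - X 1 * v 0)]
    exact pow_eq_zero_iff two_ne_zero |>.1 (le_antisymm this (sq_nonneg _))
  have h2' : v 2 = 0 := by
    have : X 2 * v 2 = 0 := by rw [h0, h1] at h; linarith
    exact (mul_eq_zero.1 this).resolve_left fun h => by simp [h] at h2
  exact hv (by ext i; fin_cases i <;> simp [h0, h1, h2'])

lemma lor_self_nonneg {X v : L3} (hX : lor X X = -1) (h : lor X v = 0) : 0 ≤ lor v v := by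
  by_cases hv : v = 0
  · simp [hv, lor]
  · exact (lor_self_pos hX h hv).le

lemma prodForm_self_pos {X : L3} {V : L3R} (hX : lor X X = -1) (h : lor X V.1 = 0)
    (hV : V ≠ 0) : 0 < prodForm V V := by
  by_cases hv : V.1 = 0
  · have : V.2 ≠ 0 := fun h2 => hV (Prod.ext hv h2)
    have : 0 < V.2 * V.2 := mul_self_pos.2 this
    simpa [prodForm, hv, lor] using this
  · exact add_pos_of_pos_of_nonneg (lor_self_pos hX h hv) (mul_self_nonneg _)

/-- An adapted frame at a point over `X ∈ ℍ²`: a basis `e` of a tangent plane of a surface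
together with a unit normal `η`. -/
structure IsSurfaceFrame (X : L3) (e : Fin 2 → L3R) (η : L3R) : Prop where
  base : lor X X = -1
  tangent : ∀ i, lor X (e i).1 = 0
  indep : LinearIndependent ℝ e
  normal_tangent : lor X η.1 = 0
  normal : ∀ i, prodForm (e i) η = 0
  unit : prodForm η η = 1

namespace IsSurfaceFrame

variable {X : L3} {e : Fin 2 → L3R} {η : L3R}

/-- The position vector `(X, 0)` completes the frame to a basis of the four-dimensional space;
pairing with `X` shows that its coefficient vanishes for vectors tangent to `ℍ² × ℝ`. -/
lemma exists_coords (h : IsSurfaceFrame X e η) {V : L3R} (hV : lor X V.1 = 0) :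
    ∃ a b d : ℝ, V = a • e 0 + b • e 1 + d • η := by
  have hli : LinearIndependent ℝ ![e 0, e 1, η, ((X, 0) : L3R)] := by
    rw [Fintype.linearIndependent_iff]
    intro g hg
    simp only [Fin.sum_univ_four, Matrix.cons_val_zero, Matrix.cons_val_one, Matrix.cons_val] at hg
    have h3 : g 3 = 0 := by
      have := congrArg (fun V : L3R => lor X V.1) hg
      simp only [Prod.fst_add, Prod.smul_fst, lor_add_right, lor_smul_right, h.tangent,
        h.normal_tangent, h.base] at this
      simp [lor] at this
      exact this
    have h2 : g 2 = 0 := by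
      have := congrArg (fun V : L3R => prodForm V η) hg
      simp only [prodForm_add_left, prodForm_smul_left, h.normal, h.unit, h3] at this
      simp [prodForm, lor] at this
      exact this
    have h01 : ∑ i : Fin 2, ![g 0, g 1] i • e i = 0 := by
      simpa [Fin.sum_univ_two, h2, h3] using hg
    have := Fintype.linearIndependent_iff.1 h.indep _ h01
    intro i
    fin_cases i
    · simpa using this 0
    · simpa using this 1
    · exact h2
    · exact h3
  have hsp := hli.span_eq_top_of_card_eq_finrank (by simp)
  have hVm : V ∈ Submodule.span ℝ (range ![e 0, e 1, η, ((X, 0) : L3R)]) := by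
    rw [hsp]; trivial
  obtain ⟨g, hg⟩ := (Submodule.mem_span_range_iff_exists_fun ℝ).1 hVm
  simp only [Fin.sum_univ_four, Matrix.cons_val_zero, Matrix.cons_val_one, Matrix.cons_val] at hg
  have h3 : g 3 = 0 := by
    have := congrArg (fun V : L3R => lor X V.1) hg
    simp only [Prod.fst_add, Prod.smul_fst, lor_add_right, lor_smul_right, h.tangent,
      h.normal_tangent, h.base, hV] at this
    linarith
  exact ⟨g 0, g 1, g 2, by rw [← hg, h3]; simp⟩

lemma gram_pos (h : IsSurfaceFrame X e η) :
    0 < prodForm (e 0) (e 0) ∧ 0 < prodForm (e 0) (e 0) * prodForm (e 1) (e 1) -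
      prodForm (e 0) (e 1) ^ 2 := by
  have h0 : 0 < prodForm (e 0) (e 0) :=
    prodForm_self_pos h.base (h.tangent 0) (h.indep.ne_zero 0)
  refine ⟨h0, ?_⟩
  -- A multiple of the Gram–Schmidt component of `e 1` orthogonal to `e 0`; its squared length is
  -- the Gram determinant times `prodForm (e 0) (e 0)`.
  set w : L3R := prodForm (e 0) (e 0) • e 1 + (-prodForm (e 0) (e 1)) • e 0 with hw
  have hw0 : w ≠ 0 := by
    intro hz
    have := Fintype.linearIndependent_iff.1 h.indep
      ![-prodForm (e 0) (e 1), prodForm (e 0) (e 0)] (by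
        simp only [Fin.sum_univ_two, Matrix.cons_val_zero, Matrix.cons_val_one]
        rw [add_comm]; exact hz) 1
    simp at this
    exact h0.ne' this
  have hpos : 0 < prodForm w w := prodForm_self_pos h.base (by
    simp only [hw, Prod.fst_add, Prod.smul_fst, lor_add_right, lor_smul_right, h.tangent]
    ring) hw0
  have hexp : prodForm w w = prodForm (e 0) (e 0) *
      (prodForm (e 0) (e 0) * prodForm (e 1) (e 1) - prodForm (e 0) (e 1) ^ 2) := by
    simp only [hw, prodForm_add_left, prodForm_add_right, prodForm_smul_left, prodForm_smul_right]
    rw [prodForm_comm (e 1) (e 0)]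
    ring
  rw [hexp] at hpos
  exact (pos_iff_pos_of_mul_pos hpos).1 h0

end IsSurfaceFrame

/-- The trace, with respect to the Gram matrix of `e`, of the bilinear form with matrix `b`. -/
def gramTrace (e : Fin 2 → L3R) (b : Fin 2 → Fin 2 → ℝ) : ℝ :=
  (prodForm (e 1) (e 1) * b 0 0 - prodForm (e 0) (e 1) * (b 0 1 + b 1 0) +
    prodForm (e 0) (e 0) * b 1 1) /
    (prodForm (e 0) (e 0) * prodForm (e 1) (e 1) - prodForm (e 0) (e 1) ^ 2)

lemma trace_inv_mul_eq_gramTrace (e : Fin 2 → L3R) (b : Fin 2 → Fin 2 → ℝ) :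
    ((Matrix.of fun i j => prodForm (e i) (e j))⁻¹ * Matrix.of b).trace = gramTrace e b := by
  rw [Matrix.inv_def, Matrix.adjugate_fin_two, Matrix.det_fin_two, Ring.inverse_eq_inv']
  simp only [Matrix.trace_fin_two, Matrix.mul_apply, Fin.sum_univ_two, Matrix.smul_apply,
    Matrix.of_apply, Matrix.cons_val_zero, Matrix.cons_val_one, Matrix.cons_val', smul_eq_mul,
    Matrix.cons_val_fin_one, gramTrace, prodForm_comm (e 1) (e 0)]
  rw [div_eq_mul_inv, sq]
  ring

lemma gramTrace_add (e : Fin 2 → L3R) (b b' : Fin 2 → Fin 2 → ℝ) :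
    gramTrace e (fun i j => b i j + b' i j) = gramTrace e b + gramTrace e b' := by
  simp only [gramTrace]; ring

lemma gramTrace_const_mul (e : Fin 2 → L3R) (r : ℝ) (b : Fin 2 → Fin 2 → ℝ) :
    gramTrace e (fun i j => r * b i j) = r * gramTrace e b := by
  simp only [gramTrace]; ring

namespace IsSurfaceFrame

variable {X : L3} {e : Fin 2 → L3R} {η : L3R}

lemma gramTrace_prodForm (h : IsSurfaceFrame X e η) :
    gramTrace e (fun i j => prodForm (e i) (e j)) = 2 := by
  have := h.gram_pos.2.ne'
  simp only [gramTrace, prodForm_comm (e 1) (e 0)]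
  rw [div_eq_iff this]
  ring

/-- The trace of the square of a linear form is the squared length of the tangential part of `V`, by
Pythagoras the total minus the normal part. -/
lemma gramTrace_mul (h : IsSurfaceFrame X e η) {V : L3R} (hV : lor X V.1 = 0) :
    gramTrace e (fun i j => prodForm V (e i) * prodForm V (e j)) =
      prodForm V V - prodForm V η ^ 2 := by
  obtain ⟨a, b, d, rfl⟩ := h.exists_coords hV
  have h1 := h.gram_pos.2.ne'
  have n0 := h.normal 0
  have n1 := h.normal 1
  have n0' := prodForm_comm η (e 0) ▸ n0
  have n1' := prodForm_comm η (e 1) ▸ n1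
  simp only [gramTrace, prodForm_add_left, prodForm_add_right, prodForm_smul_left,
    prodForm_smul_right, prodForm_comm (e 1) (e 0), n0, n1, n0', n1', h.unit]
  rw [div_eq_iff h1]
  ring

lemma gramTrace_nonpos (h : IsSurfaceFrame X e η) {b : Fin 2 → Fin 2 → ℝ}
    (hb : ∀ x y : ℝ, x ^ 2 * b 0 0 + x * y * (b 0 1 + b 1 0) + y ^ 2 * b 1 1 ≤ 0) :
    gramTrace e b ≤ 0 := by
  obtain ⟨h0, h1⟩ := h.gram_pos
  refine div_nonpos_of_nonpos_of_nonneg ?_ h1.le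
  have k1 := hb (-prodForm (e 0) (e 1)) (prodForm (e 0) (e 0))
  have k2 := hb 1 0
  set E := prodForm (e 0) (e 0)
  set F := prodForm (e 0) (e 1)
  set G := prodForm (e 1) (e 1)
  -- The left side is the form at `(-F, E)` plus `EG - F²` times the form at `(1, 0)`.
  have k3 : E * (G * b 0 0 - F * (b 0 1 + b 1 0) + E * b 1 1) ≤ 0 := by
    nlinarith
  exact nonpos_of_mul_nonpos_right k3 h0

end IsSurfaceFrame

/-! ### The Hessian of the height above a rotational graph -/

/-- The left-hand side of the equation `bowlOp t U' U'' = 0` for a function `U` of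
`t = sinh² r` whose vertical graph is a translating soliton. -/
def bowlOp (t p p' : ℝ) : ℝ :=
  2 * t * (1 + t) * p' + (2 + 3 * t) * p + 4 * t * (1 + t) ^ 2 * p ^ 3 - 1 -
    4 * t * (1 + t) * p ^ 2

/-- Strict monotonicity in the slope `p`, the source of strict sub- and supersolutions. The factor
`m` is the difference quotient in `p`. -/
lemma bowlOp_perturb {t : ℝ} (ht : 0 ≤ t) (p p' ε : ℝ) :
    ∃ m, 0 < m ∧ bowlOp t (p + ε) p' = bowlOp t p p' + ε * m := by
  refine ⟨2 + 3 * t + 4 * t * (3 * ((1 + t) * p) ^ 2 + 3 * ((1 + t) * p) * ((1 + t) * ε) +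
    ((1 + t) * ε) ^ 2 - 2 * ((1 + t) * p) - (1 + t) * ε), ?_, ?_⟩
  · set y := (1 + t) * p
    set d := (1 + t) * ε
    -- The quadratic has minimum `-1/3`, so `m ≥ 2 + 3t - 4t/3 > 0`.
    have : -(1 / 3) ≤ 3 * y ^ 2 + 3 * y * d + d ^ 2 - 2 * y - d := by
      nlinarith [sq_nonneg (6 * y + 3 * d - 2), sq_nonneg d]
    nlinarith
  · simp only [bowlOp]
    ring

/-- The matrix of the Hessian, at a critical point, of the restriction to a surface of the function
`z - φ(⟨x, c⟩² - 1)` with `φ' = p` and `φ'' = p'`; here `h` is the second fundamental form and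
`β` is the length of the gradient, with a sign. -/
def restrictedHessian (X c : L3) (e : Fin 2 → L3R) (h : Fin 2 → Fin 2 → ℝ) (β p p' : ℝ)
    (i j : Fin 2) : ℝ :=
  β * h i j + (2 * lor X c ^ 2 * p) * (-lor (e i).1 (e j).1) +
    (-(2 * p + 4 * lor X c ^ 2 * p')) * (lor c (e i).1 * lor c (e j).1)

/-- The gradient in `ℍ² × ℝ` of the function `z - φ(⟨x, c⟩² - 1)` with `φ' = p`. -/
def heightGradient (X c : L3) (p : ℝ) : L3R :=
  ((-2 * p * lor X c) • (c + lor X c • X), 1)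

lemma lor_heightGradient {X c : L3} (hX : lor X X = -1) (p : ℝ) :
    lor X (heightGradient X c p).1 = 0 := by
  simp only [heightGradient, lor_smul_right, lor_add_right, hX]
  ring

lemma prodForm_heightGradient_self {X c : L3} (hX : lor X X = -1) (hc : lor c c = -1) (p : ℝ) :
    prodForm (heightGradient X c p) (heightGradient X c p) =
      1 + 4 * p ^ 2 * lor X c ^ 2 * (lor X c ^ 2 - 1) := by
  simp only [heightGradient, prodForm, lor_smul_left, lor_smul_right, lor_add_left, lor_add_right,
    hX, hc, lor_comm c X]
  ring

/-- At a critical point the gradient has no tangential part, so it is a multiple of `η`. Its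
vertical component is `1`, which links `β` to the angle function. -/
lemma IsSurfaceFrame.heightGradient_eq {X c : L3} {e : Fin 2 → L3R} {η : L3R}
    (h : IsSurfaceFrame X e η) (hc : lor c c = -1) {p : ℝ}
    (hcrit : ∀ i, prodForm (heightGradient X c p) (e i) = 0) :
    ∃ β, heightGradient X c p = β • η ∧ β * prodForm η vert = 1 ∧
      β ^ 2 = 1 + 4 * p ^ 2 * lor X c ^ 2 * (lor X c ^ 2 - 1) := by
  have ht := lor_heightGradient (c := c) h.base p
  set N := heightGradient X c p with hN
  obtain ⟨a, b, d, hd⟩ := h.exists_coords ht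
  have hw : N - d • η = 0 := by
    by_contra hne
    have hpos : 0 < prodForm (N - d • η) (N - d • η) := by
      refine prodForm_self_pos h.base ?_ hne
      simp only [Prod.fst_sub, Prod.smul_fst, lor_sub_right, lor_smul_right, ht, h.normal_tangent]
      ring
    have e1 : N - d • η = a • e 0 + b • e 1 := by rw [hd]; abel
    have e2 : prodForm (N - d • η) (N - d • η) = 0 := by
      rw [e1]
      nth_rewrite 1 [← e1]
      have n0 := prodForm_comm η (e 0) ▸ h.normal 0
      have n1 := prodForm_comm η (e 1) ▸ h.normal 1
      rw [sub_eq_add_neg, ← neg_smul]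
      simp only [prodForm_add_left, prodForm_smul_left, prodForm_add_right, prodForm_smul_right,
        hcrit, n0, n1]
      ring
    exact hpos.ne' e2
  have hNd : N = d • η := sub_eq_zero.1 hw
  refine ⟨d, hNd, ?_, ?_⟩
  · rw [← prodForm_smul_left, ← hNd]
    simp [hN, heightGradient, prodForm, vert, lor]
  · rw [← prodForm_heightGradient_self h.base hc, ← hN, hNd, prodForm_smul_left,
      prodForm_smul_right, h.unit]
    ring

/-- The trace of the Hessian of `z - φ(⟨x, c⟩² - 1)` on a surface, at a critical point. -/
lemma IsSurfaceFrame.gramTrace_restrictedHessian {X c : L3} {e : Fin 2 → L3R} {η : L3R}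
    (h : IsSurfaceFrame X e η) (hc : lor c c = -1) {p : ℝ} (p' : ℝ) {β : ℝ}
    (hβ : heightGradient X c p = β • η) (hβv : β * prodForm η vert = 1)
    (hβs : β ^ 2 = 1 + 4 * p ^ 2 * lor X c ^ 2 * (lor X c ^ 2 - 1)) (b : Fin 2 → Fin 2 → ℝ) :
    β ^ 2 * gramTrace e (restrictedHessian X c e b β p p') =
      β ^ 2 * (β * gramTrace e b - 2) - 2 * bowlOp (lor X c ^ 2 - 1) p p' := by
  -- The horizontal metric is the full metric minus `dz²`, so its trace is `2` minus the squared
  -- tangential length of `∂_z`.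
  have hz : gramTrace e (fun i j => -lor (e i).1 (e j).1) = -2 + (1 - prodForm η vert ^ 2) := by
    have e1 : ∀ i j, -lor (e i).1 (e j).1 =
        (-1) * prodForm (e i) (e j) + prodForm vert (e i) * prodForm vert (e j) := by
      intro i j
      simp only [prodForm, vert, lor, Pi.zero_apply]
      ring
    have e2 : prodForm vert vert = 1 := by simp [prodForm, vert, lor]
    have e3 := h.gramTrace_mul (V := vert) (by simp [vert, lor])
    simp only [e1]
    rw [gramTrace_add, gramTrace_const_mul, h.gramTrace_prodForm, e3, e2, prodForm_comm vert η]
    ring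
  -- The projection of `c` to the tangent plane of `ℍ²` at `X`; the height gradient is a multiple of
  -- it plus `∂_z`.
  set C : L3R := (c + lor X c • X, 0) with hC
  have hCX : lor X C.1 = 0 := by
    simp only [hC, lor_add_right, lor_smul_right, h.base]; ring
  have hCC : prodForm C C = lor X c ^ 2 - 1 := by
    simp only [hC, prodForm, lor_add_right, lor_smul_right, lor_add_left, lor_smul_left, h.base, hc,
      lor_comm c X]
    ring
  have hCη : β * prodForm C η = -2 * p * lor X c * (lor X c ^ 2 - 1) := by
    rw [← prodForm_smul_right, ← hβ]
    simp only [hC, heightGradient, prodForm, lor_add_right, lor_smul_right, lor_add_left,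
      lor_smul_left, h.base, hc, lor_comm c X]
    ring
  have hcc : gramTrace e (fun i j => lor c (e i).1 * lor c (e j).1) =
      lor X c ^ 2 - 1 - prodForm C η ^ 2 := by
    have e1 : ∀ i, lor c (e i).1 = prodForm C (e i) := by
      intro i
      simp only [hC, prodForm, lor_add_left, lor_smul_left, h.tangent]
      ring
    simp only [e1]
    rw [h.gramTrace_mul hCX, hCC]
  have hsum : gramTrace e (restrictedHessian X c e b β p p') = β * gramTrace e b +
      (2 * lor X c ^ 2 * p) * (-2 + (1 - prodForm η vert ^ 2)) +
      (-(2 * p + 4 * lor X c ^ 2 * p')) * (lor X c ^ 2 - 1 - prodForm C η ^ 2) := by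
    rw [← hz, ← hcc, ← gramTrace_const_mul, ← gramTrace_const_mul, ← gramTrace_const_mul,
      ← gramTrace_add, ← gramTrace_add]
    rfl
  rw [hsum]
  have hv2 : β ^ 2 * prodForm η vert ^ 2 = 1 := by rw [← mul_pow, hβv, one_pow]
  have hC2 : β ^ 2 * prodForm C η ^ 2 = (-2 * p * lor X c * (lor X c ^ 2 - 1)) ^ 2 := by
    rw [← mul_pow, hCη]
  simp only [bowlOp]
  linear_combination (-(2 * lor X c ^ 2 * p)) * hv2 + (2 * p + 4 * lor X c ^ 2 * p') * hC2 +
    (2 - 2 * lor X c ^ 2 * p - (2 * p + 4 * lor X c ^ 2 * p') * (lor X c ^ 2 - 1)) * hβs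

lemma HasDerivAt.lor {x y : ℝ → L3} {x' y' : L3} {t : ℝ} (hx : HasDerivAt x x' t)
    (hy : HasDerivAt y y' t) :
    HasDerivAt (fun t => lor (x t) (y t)) (lor x' (y t) + lor (x t) y') t := by
  have hx' := fun i => hasDerivAt_pi.1 hx i
  have hy' := fun i => hasDerivAt_pi.1 hy i
  refine ((((hx' 0).mul (hy' 0)).add ((hx' 1).mul (hy' 1))).sub
    ((hx' 2).mul (hy' 2))).congr_deriv ?_
  simp only [_root_.lor]
  ring

lemma hasDerivAt_prod_fst {V : ℝ → L3R} {V' : L3R} {t : ℝ} (h : HasDerivAt V V' t) :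
    HasDerivAt (fun t => (V t).1) V'.1 t :=
  (ContinuousLinearMap.fst ℝ L3 ℝ).hasFDerivAt.comp_hasDerivAt t h

lemma hasDerivAt_prod_snd {V : ℝ → L3R} {V' : L3R} {t : ℝ} (h : HasDerivAt V V' t) :
    HasDerivAt (fun t => (V t).2) V'.2 t :=
  (ContinuousLinearMap.snd ℝ L3 ℝ).hasFDerivAt.comp_hasDerivAt t h

lemma HasDerivAt.prodForm {V W : ℝ → L3R} {V' W' : L3R} {t : ℝ} (hV : HasDerivAt V V' t)
    (hW : HasDerivAt W W' t) :
    HasDerivAt (fun t => prodForm (V t) (W t)) (prodForm V' (W t) + prodForm (V t) W') t := by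
  refine (((hasDerivAt_prod_fst hV).lor (hasDerivAt_prod_fst hW)).add
    ((hasDerivAt_prod_snd hV).mul (hasDerivAt_prod_snd hW))).congr_deriv ?_
  simp only [_root_.prodForm]
  ring

/-- A positive second derivative would make the point a local minimum as well; the function would
then be locally constant, with zero second derivative. -/
lemma deriv_deriv_nonpos_of_isLocalMax {g : ℝ → ℝ} {t : ℝ} (hg : ContinuousAt g t)
    (h : IsLocalMax g t) : deriv (deriv g) t ≤ 0 := by
  by_contra hc
  have hmin := isLocalMin_of_deriv_deriv_pos (not_le.1 hc) h.deriv_eq_zero hg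
  have he : g =ᶠ[𝓝 t] fun _ => g t := by
    filter_upwards [h, hmin] with x h1 h2 using le_antisymm h1 h2
  have : deriv (deriv g) t = 0 := by
    rw [he.deriv.deriv_eq]
    simp
  exact hc this.le

/-- The height above the graph of `φ`, as a function on `ℍ² × ℝ`. -/
def heightAbove (φ : ℝ → ℝ) (c : L3) (P : L3R) : ℝ := P.2 - φ (lor P.1 c ^ 2 - 1)

lemma hasDerivAt_heightAbove {φ : ℝ → ℝ} {c : L3} {σ : ℝ → L3R} {V : L3R} {t p : ℝ}
    (hφ : HasDerivAt φ p (lor (σ t).1 c ^ 2 - 1)) (hσ : HasDerivAt σ V t) :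
    HasDerivAt (fun t => heightAbove φ c (σ t))
      (V.2 - p * (2 * lor (σ t).1 c * lor V.1 c)) t := by
  have h1 : HasDerivAt (fun t => lor (σ t).1 c) (lor V.1 c) t := by
    refine ((hasDerivAt_prod_fst hσ).lor (hasDerivAt_const t c)).congr_deriv ?_
    simp [lor]
  have h2 : HasDerivAt (fun t => lor (σ t).1 c ^ 2 - 1) (2 * lor (σ t).1 c * lor V.1 c) t := by
    refine ((h1.pow 2).sub_const 1).congr_deriv ?_
    simp
  exact (hasDerivAt_prod_snd hσ).sub (hφ.comp t h2)

/-- The second derivative, at a critical point, of the height above the graph of `φ` along a curve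
in a surface with unit normal `N`. -/
lemma hasDerivAt_deriv_heightAbove {φ : ℝ → ℝ} {c : L3} {σ σ' N : ℝ → L3R} {A N' : L3R}
    (hσ : ∀ᶠ t in 𝓝 (0 : ℝ), HasDerivAt σ (σ' t) t) (hσ' : HasDerivAt σ' A 0)
    (hN : HasDerivAt N N' 0) (hX : ∀ᶠ t in 𝓝 (0 : ℝ), lor (σ t).1 (σ t).1 = -1)
    (horth : ∀ᶠ t in 𝓝 (0 : ℝ), prodForm (σ' t) (N t) = 0)
    (hφ : ContDiffAt ℝ 2 φ (lor (σ 0).1 c ^ 2 - 1)) {β p p' : ℝ}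
    (hp : deriv φ (lor (σ 0).1 c ^ 2 - 1) = p)
    (hp' : deriv (deriv φ) (lor (σ 0).1 c ^ 2 - 1) = p')
    (hβ : heightGradient (σ 0).1 c p = β • N 0) :
    deriv (deriv fun t => heightAbove φ c (σ t)) 0 =
      β * -prodForm N' (σ' 0) + (2 * lor (σ 0).1 c ^ 2 * p) * (-lor (σ' 0).1 (σ' 0).1) +
      (-(2 * p + 4 * lor (σ 0).1 c ^ 2 * p')) * (lor c (σ' 0).1 * lor c (σ' 0).1) := by
  have hl : HasDerivAt (fun t => lor (σ t).1 c) (lor (σ' 0).1 c) 0 := by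
    refine ((hasDerivAt_prod_fst hσ.self_of_nhds).lor (hasDerivAt_const 0 c)).congr_deriv ?_
    simp [lor]
  have hl' : HasDerivAt (fun t => lor (σ' t).1 c) (lor A.1 c) 0 := by
    refine ((hasDerivAt_prod_fst hσ').lor (hasDerivAt_const 0 c)).congr_deriv ?_
    simp [lor]
  have hτ : HasDerivAt (fun t => lor (σ t).1 c ^ 2 - 1)
      (2 * lor (σ 0).1 c * lor (σ' 0).1 c) 0 := by
    refine ((hl.pow 2).sub_const 1).congr_deriv ?_
    simp
  have hφ1 : ∀ᶠ s in 𝓝 (lor (σ 0).1 c ^ 2 - 1), DifferentiableAt ℝ φ s := by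
    filter_upwards [hφ.eventually (by simp)] with s hs using hs.differentiableAt (by simp)
  have hφ2 : HasDerivAt (deriv φ) p' (lor (σ 0).1 c ^ 2 - 1) := by
    rw [← hp']
    refine DifferentiableAt.hasDerivAt ?_
    exact ((hφ.fderiv_right (m := 1) (by norm_num)).differentiableAt (by simp)).clm_apply
      (differentiableAt_const 1)
  have h1 : deriv (fun t => heightAbove φ c (σ t)) =ᶠ[𝓝 0] fun t =>
      (σ' t).2 - deriv φ (lor (σ t).1 c ^ 2 - 1) * (2 * lor (σ t).1 c * lor (σ' t).1 c) := by
    filter_upwards [hσ, hτ.continuousAt.eventually hφ1] with t h1 h2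
    exact (hasDerivAt_heightAbove h2.hasDerivAt h1).deriv
  have h2 : HasDerivAt (fun t => (σ' t).2 - deriv φ (lor (σ t).1 c ^ 2 - 1) *
      (2 * lor (σ t).1 c * lor (σ' t).1 c)) _ 0 :=
    (hasDerivAt_prod_snd hσ').sub ((HasDerivAt.comp (h₂ := deriv φ) 0 hφ2 hτ).mul ((hl.const_mul 2).mul hl'))
  rw [h1.deriv_eq, h2.deriv]
  -- Differentiating `⟨σ, σ⟩ = -1` twice gives `e1`, differentiating `⟨σ', N⟩ = 0` gives `e2`. With
  -- `e3`, where the gradient is `β • N`, they eliminate the acceleration `A`.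
  have e1 : lor (σ' 0).1 (σ' 0).1 + lor (σ 0).1 A.1 = 0 := by
    have hXX : ∀ᶠ t in 𝓝 (0 : ℝ), lor (σ t).1 (σ' t).1 = 0 := by
      filter_upwards [hσ, hX.eventually_nhds] with t h1 h2
      have h3 := ((hasDerivAt_prod_fst h1).lor (hasDerivAt_prod_fst h1)).deriv
      have h4 : deriv (fun t => lor (σ t).1 (σ t).1) t = 0 := by
        have : (fun t => lor (σ t).1 (σ t).1) =ᶠ[𝓝 t] fun _ => -1 := h2
        rw [this.deriv_eq]
        simp
      rw [h4, lor_comm (σ' t).1] at h3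
      linarith
    have h3 := ((hasDerivAt_prod_fst hσ.self_of_nhds).lor (hasDerivAt_prod_fst hσ')).deriv
    have h4 : deriv (fun t => lor (σ t).1 (σ' t).1) 0 = 0 := by
      have : (fun t => lor (σ t).1 (σ' t).1) =ᶠ[𝓝 0] fun _ => 0 := hXX
      rw [this.deriv_eq]
      simp
    rw [← h3, h4]
  have e2 : prodForm A (N 0) + prodForm (σ' 0) N' = 0 := by
    have : (fun t => prodForm (σ' t) (N t)) =ᶠ[𝓝 0] fun _ => 0 := horth
    rw [← (hσ'.prodForm hN).deriv, this.deriv_eq]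
    simp
  have e3 : β * prodForm A (N 0) = A.2 - 2 * p * lor (σ 0).1 c *
      (lor A.1 c + lor (σ 0).1 c * lor (σ 0).1 A.1) := by
    rw [← prodForm_smul_right, ← hβ]
    simp only [heightGradient, prodForm, lor_smul_right, lor_add_right, lor_comm A.1 (σ 0).1]
    ring
  rw [prodForm_comm N', lor_comm c]
  simp only [Function.comp]
  rw [hp]
  linear_combination -e3 + β * e2 + 2 * p * lor (σ 0).1 c ^ 2 * e1

/-! ### The touching principle for parametrised surfaces -/

section Flat

variable {Ψ N : E2 → L3R} {y : E2}

lemma partialAt_model (f : E2 → L3R) (y : E2) (i : Fin 2) :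
    partialAt 𝓘(ℝ, E2) f y i = fderiv ℝ f y (EuclideanSpace.single i 1) := by
  simp only [partialAt, mfderiv_eq_fderiv]

lemma exists_coords_E2 (v : E2) : v = v 0 • EuclideanSpace.single 0 (1 : ℝ) +
    v 1 • EuclideanSpace.single 1 (1 : ℝ) := by
  ext i
  fin_cases i <;> simp

lemma hasDerivAt_line (hΨ : ContDiffAt ℝ 2 Ψ y) (v : E2) :
    ∀ᶠ t in 𝓝 (0 : ℝ), HasDerivAt (fun t : ℝ => Ψ (y + t • v)) (fderiv ℝ Ψ (y + t • v) v) t := by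
  have hc : Filter.Tendsto (fun t : ℝ => y + t • v) (𝓝 0) (𝓝 y) := by
    have : Continuous fun t : ℝ => y + t • v := by fun_prop
    simpa using this.tendsto 0
  filter_upwards [hc.eventually (hΨ.eventually (by simp))] with t ht
  have h1 : HasDerivAt (fun t : ℝ => y + t • v) v t := by
    simpa using ((hasDerivAt_id t).smul_const v).const_add y
  exact (ht.differentiableAt (by simp)).hasFDerivAt.comp_hasDerivAt t h1

lemma lor_fderiv_eq_zero (hΨ : ContDiffAt ℝ 2 Ψ y)
    (hX : ∀ᶠ x in 𝓝 y, lor (Ψ x).1 (Ψ x).1 = -1) (v : E2) :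
    lor (Ψ y).1 (fderiv ℝ Ψ y v).1 = 0 := by
  have h1 := (hasDerivAt_line hΨ v).self_of_nhds
  have hc : Filter.Tendsto (fun t : ℝ => y + t • v) (𝓝 0) (𝓝 y) := by
    have : Continuous fun t : ℝ => y + t • v := by fun_prop
    simpa using this.tendsto 0
  have h2 : (fun t : ℝ => lor (Ψ (y + t • v)).1 (Ψ (y + t • v)).1) =ᶠ[𝓝 0] fun _ => -1 :=
    hc.eventually hX
  have h3 := ((hasDerivAt_prod_fst h1).lor (hasDerivAt_prod_fst h1)).deriv
  rw [h2.deriv_eq] at h3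
  simp only [deriv_const, zero_smul, add_zero] at h3
  rw [lor_comm (fderiv ℝ Ψ y v).1] at h3
  linarith

lemma heightGradient_orthogonal (hΨ : ContDiffAt ℝ 2 Ψ y)
    (hX : ∀ᶠ x in 𝓝 y, lor (Ψ x).1 (Ψ x).1 = -1) {φ : ℝ → ℝ} {c : L3} {p : ℝ}
    (hφ : HasDerivAt φ p (lor (Ψ y).1 c ^ 2 - 1)) {v : E2}
    (hcrit : deriv (fun t : ℝ => heightAbove φ c (Ψ (y + t • v))) 0 = 0) :
    prodForm (heightGradient (Ψ y).1 c p) (fderiv ℝ Ψ y v) = 0 := by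
  have e0 : y + (0 : ℝ) • v = y := by simp
  have h1 := (hasDerivAt_line hΨ v).self_of_nhds
  have h2 := (hasDerivAt_heightAbove (φ := φ) (c := c) (p := p) (by rwa [e0]) h1).deriv
  rw [hcrit, e0] at h2
  simp only [heightGradient, prodForm, lor_smul_left, lor_add_left, lor_fderiv_eq_zero hΨ hX]
  rw [lor_comm c]
  linarith

/-- `Ψ`, with unit normal `N`, is near `y` a parametrised surface in `ℍ² × ℝ`. -/
structure IsLocalSurface (Ψ N : E2 → L3R) (y : E2) : Prop where
  smooth : ContDiffAt ℝ 2 Ψ y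
  smooth_normal : ContDiffAt ℝ 1 N y
  mem : ∀ᶠ x in 𝓝 y, lor (Ψ x).1 (Ψ x).1 = -1
  normal : ∀ᶠ x in 𝓝 y, ∀ v, prodForm (fderiv ℝ Ψ x v) (N x) = 0
  tangent : lor (Ψ y).1 (N y).1 = 0
  unit : prodForm (N y) (N y) = 1
  injective : Function.Injective (fderiv ℝ Ψ y)

namespace IsLocalSurface

lemma isSurfaceFrame (h : IsLocalSurface Ψ N y) :
    IsSurfaceFrame (Ψ y).1 (partialAt 𝓘(ℝ, E2) Ψ y) (N y) where
  base := h.mem.self_of_nhds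
  tangent i := by rw [partialAt_model]; exact lor_fderiv_eq_zero h.smooth h.mem _
  indep := by
    rw [Fintype.linearIndependent_iff]
    intro g hg
    simp only [partialAt_model, ← map_smul, ← map_sum] at hg
    have h0 := h.injective (hg.trans (map_zero _).symm)
    rw [Fin.sum_univ_two] at h0
    intro i
    have := congrArg (fun v : E2 => v i) h0
    fin_cases i <;> simpa using this
  normal_tangent := h.tangent
  normal i := by rw [partialAt_model]; exact h.normal.self_of_nhds _
  unit := h.unit

/-- The Hessian of the height above the graph of `φ` at a critical point. -/
lemma deriv_deriv_heightAbove (h : IsLocalSurface Ψ N y) {φ : ℝ → ℝ} {c : L3}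
    (hφ : ContDiffAt ℝ 2 φ (lor (Ψ y).1 c ^ 2 - 1)) {β p p' : ℝ}
    (hp : deriv φ (lor (Ψ y).1 c ^ 2 - 1) = p)
    (hp' : deriv (deriv φ) (lor (Ψ y).1 c ^ 2 - 1) = p')
    (hβ : heightGradient (Ψ y).1 c p = β • N y) (v : E2) :
    let k := restrictedHessian (Ψ y).1 c (partialAt 𝓘(ℝ, E2) Ψ y)
      (fun i j => secondForm 𝓘(ℝ, E2) Ψ N y i j) β p p'
    deriv (deriv fun t : ℝ => heightAbove φ c (Ψ (y + t • v))) 0 =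
      v 0 ^ 2 * k 0 0 + v 0 * v 1 * (k 0 1 + k 1 0) + v 1 ^ 2 * k 1 1 := by
  intro k
  have hc : Filter.Tendsto (fun t : ℝ => y + t • v) (𝓝 0) (𝓝 y) := by
    have : Continuous fun t : ℝ => y + t • v := by fun_prop
    simpa using this.tendsto 0
  have hline : HasDerivAt (fun t : ℝ => y + t • v) v 0 := by
    simpa using ((hasDerivAt_id (0 : ℝ)).smul_const v).const_add y
  have e0 : y + (0 : ℝ) • v = y := by simp
  have hD : HasDerivAt (fun t : ℝ => fderiv ℝ Ψ (y + t • v) v)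
      (fderiv ℝ (fderiv ℝ Ψ) y v v) 0 := by
    have h1 : HasFDerivAt (fderiv ℝ Ψ) (fderiv ℝ (fderiv ℝ Ψ) y) (y + (0 : ℝ) • v) := by
      rw [e0]
      exact ((h.smooth.fderiv_right (m := 1) (by norm_num)).differentiableAt
        (by simp)).hasFDerivAt
    exact (ContinuousLinearMap.apply ℝ L3R v).hasFDerivAt.comp_hasDerivAt 0
      (h1.comp_hasDerivAt 0 hline)
  have hN : HasDerivAt (fun t : ℝ => N (y + t • v)) (fderiv ℝ N y v) 0 := by
    have h1 : HasFDerivAt N (fderiv ℝ N y) (y + (0 : ℝ) • v) := by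
      rw [e0]
      exact (h.smooth_normal.differentiableAt (by simp)).hasFDerivAt
    exact h1.comp_hasDerivAt 0 hline
  have key := hasDerivAt_deriv_heightAbove (φ := φ) (c := c) (β := β) (p := p) (p' := p')
    (σ := fun t : ℝ => Ψ (y + t • v)) (σ' := fun t : ℝ => fderiv ℝ Ψ (y + t • v) v)
    (N := fun t : ℝ => N (y + t • v)) (A := fderiv ℝ (fderiv ℝ Ψ) y v v) (N' := fderiv ℝ N y v)
    (hasDerivAt_line h.smooth v) hD hN (hc.eventually h.mem)
    ((hc.eventually h.normal).mono fun t ht => ht v)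
    (by simpa only [e0] using hφ) (by simpa only [e0] using hp)
    (by simpa only [e0] using hp') (by simpa only [e0] using hβ)
  simp only [e0] at key
  rw [key]
  have hv : ∀ L : E2 →L[ℝ] L3R, L v = v 0 • L (EuclideanSpace.single 0 (1 : ℝ)) +
      v 1 • L (EuclideanSpace.single 1 (1 : ℝ)) := by
    intro L
    conv_lhs => rw [exists_coords_E2 v]
    rw [map_add, map_smul, map_smul]
  rw [hv (fderiv ℝ Ψ y), hv (fderiv ℝ N y)]
  simp only [k, restrictedHessian, secondForm, Matrix.of_apply, partialAt_model, prodForm_add_left,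
    prodForm_add_right, prodForm_smul_left, prodForm_smul_right, Prod.fst_add, Prod.smul_fst,
    lor_add_left, lor_add_right, lor_smul_left, lor_smul_right]
  ring

lemma meanCurvature_eq (Ψ N : E2 → L3R) (y : E2) : meanCurvature 𝓘(ℝ, E2) Ψ N y =
    gramTrace (partialAt 𝓘(ℝ, E2) Ψ y) (fun i j => secondForm 𝓘(ℝ, E2) Ψ N y i j) / 2 := by
  rw [meanCurvature, ← trace_inv_mul_eq_gramTrace]
  rfl

/-- A soliton that touches the graph of `φ` from below satisfies `bowlOp ≥ 0` there, and one that
touches it from above satisfies `bowlOp ≤ 0`. -/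
lemma mul_bowlOp_nonneg_of_isLocalMax (h : IsLocalSurface Ψ N y)
    (hH : meanCurvature 𝓘(ℝ, E2) Ψ N y = prodForm (N y) vert) {φ : ℝ → ℝ} {c : L3}
    (hc : lor c c = -1) (hφ : ContDiffAt ℝ 2 φ (lor (Ψ y).1 c ^ 2 - 1))
    {δ : ℝ} (hδ : δ ≠ 0)
    (hmax : IsLocalMax (fun x => δ * heightAbove φ c (Ψ x)) y) :
    0 ≤ δ * bowlOp (lor (Ψ y).1 c ^ 2 - 1) (deriv φ (lor (Ψ y).1 c ^ 2 - 1))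
      (deriv (deriv φ) (lor (Ψ y).1 c ^ 2 - 1)) := by
  have hlc : ∀ v : E2, Filter.Tendsto (fun t : ℝ => y + t • v) (𝓝 0) (𝓝 y) := by
    intro v
    have : Continuous fun t : ℝ => y + t • v := by fun_prop
    simpa using this.tendsto 0
  have hφd := (hφ.differentiableAt (by simp)).hasDerivAt
  have hmaxl : ∀ v : E2, IsLocalMax (fun t : ℝ => δ * heightAbove φ c (Ψ (y + t • v))) 0 := by
    intro v
    have := (hlc v).eventually hmax
    simpa [IsLocalMax, IsMaxFilter] using this
  have hcrit : ∀ v, prodForm (heightGradient (Ψ y).1 c (deriv φ (lor (Ψ y).1 c ^ 2 - 1)))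
      (fderiv ℝ Ψ y v) = 0 := fun v =>
    heightGradient_orthogonal h.smooth h.mem hφd (by
      have := (hmaxl v).deriv_eq_zero
      rw [deriv_const_mul_field, mul_eq_zero] at this
      exact this.resolve_left hδ)
  have hF := h.isSurfaceFrame
  obtain ⟨β, hβ, hβv, hβs⟩ := hF.heightGradient_eq hc (p := deriv φ (lor (Ψ y).1 c ^ 2 - 1))
    (fun i => by rw [partialAt_model]; exact hcrit _)
  have htr := hF.gramTrace_restrictedHessian hc (deriv (deriv φ) (lor (Ψ y).1 c ^ 2 - 1))
    hβ hβv hβs (fun i j => secondForm 𝓘(ℝ, E2) Ψ N y i j)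
  have hG : gramTrace (partialAt 𝓘(ℝ, E2) Ψ y) (fun i j => secondForm 𝓘(ℝ, E2) Ψ N y i j) =
      2 * prodForm (N y) vert := by
    rw [← hH, meanCurvature_eq]; ring
  have hneg := hF.gramTrace_nonpos (b := fun i j => δ * restrictedHessian (Ψ y).1 c
      (partialAt 𝓘(ℝ, E2) Ψ y) (fun i j => secondForm 𝓘(ℝ, E2) Ψ N y i j) β
      (deriv φ (lor (Ψ y).1 c ^ 2 - 1)) (deriv (deriv φ) (lor (Ψ y).1 c ^ 2 - 1)) i j) (by
    intro a b
    have h1 := h.deriv_deriv_heightAbove hφ rfl rfl hβ (!₂[a, b] : E2)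
    simp only at h1
    have e0 : y + (0 : ℝ) • (!₂[a, b] : E2) = y := by simp
    have hcont : ContinuousAt (fun t : ℝ => heightAbove φ c (Ψ (y + t • (!₂[a, b] : E2)))) 0 :=
      (hasDerivAt_heightAbove (by rwa [e0])
        (hasDerivAt_line h.smooth (!₂[a, b] : E2)).self_of_nhds).continuousAt
    have h2 := deriv_deriv_nonpos_of_isLocalMax (hcont.const_mul δ) (hmaxl (!₂[a, b] : E2))
    have h3 : (deriv fun t : ℝ => δ * heightAbove φ c (Ψ (y + t • (!₂[a, b] : E2)))) =
        fun t => δ * (deriv fun t : ℝ => heightAbove φ c (Ψ (y + t • (!₂[a, b] : E2)))) t := by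
      funext t
      rw [deriv_const_mul_field]
    rw [h3, deriv_const_mul_field, h1] at h2
    simp only [Matrix.cons_val_zero, Matrix.cons_val_one] at h2
    linarith)
  rw [gramTrace_const_mul] at hneg
  rw [hG] at htr
  -- By the soliton equation and `β * ⟨η, ∂_z⟩ = 1` the curvature term cancels, and the trace of the
  -- Hessian is governed by `-bowlOp` alone.
  have : β ^ 2 * (β * (2 * prodForm (N y) vert) - 2) = 0 := by
    linear_combination 2 * β ^ 2 * hβv
  rw [this] at htr
  nlinarith [mul_nonneg (sq_nonneg β) (neg_nonneg.2 hneg), congrArg (fun x => δ * x) htr]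

/-- A graph of a solution of the bowl equation is a translating soliton. -/
lemma meanCurvature_of_graph (h : IsLocalSurface Ψ N y) {φ : ℝ → ℝ} {c : L3}
    (hc : lor c c = -1) (hφ : ContDiffAt ℝ 2 φ (lor (Ψ y).1 c ^ 2 - 1))
    (hconst : ∀ᶠ x in 𝓝 y, heightAbove φ c (Ψ x) = 0)
    (hφeq : bowlOp (lor (Ψ y).1 c ^ 2 - 1) (deriv φ (lor (Ψ y).1 c ^ 2 - 1))
      (deriv (deriv φ) (lor (Ψ y).1 c ^ 2 - 1)) = 0) :
    meanCurvature 𝓘(ℝ, E2) Ψ N y = prodForm (N y) vert := by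
  have hlc : ∀ v : E2, Filter.Tendsto (fun t : ℝ => y + t • v) (𝓝 0) (𝓝 y) := by
    intro v
    have : Continuous fun t : ℝ => y + t • v := by fun_prop
    simpa using this.tendsto 0
  have hφd := (hφ.differentiableAt (by simp)).hasDerivAt
  have hz : ∀ v : E2, (fun t : ℝ => heightAbove φ c (Ψ (y + t • v))) =ᶠ[𝓝 0] fun _ => 0 :=
    fun v => (hlc v).eventually hconst
  have hcrit : ∀ v, prodForm (heightGradient (Ψ y).1 c (deriv φ (lor (Ψ y).1 c ^ 2 - 1)))
      (fderiv ℝ Ψ y v) = 0 := fun v =>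
    heightGradient_orthogonal h.smooth h.mem hφd (by rw [(hz v).deriv_eq]; simp)
  have hF := h.isSurfaceFrame
  obtain ⟨β, hβ, hβv, hβs⟩ := hF.heightGradient_eq hc (p := deriv φ (lor (Ψ y).1 c ^ 2 - 1))
    (fun i => by rw [partialAt_model]; exact hcrit _)
  have htr := hF.gramTrace_restrictedHessian hc (deriv (deriv φ) (lor (Ψ y).1 c ^ 2 - 1))
    hβ hβv hβs (fun i j => secondForm 𝓘(ℝ, E2) Ψ N y i j)
  -- The height vanishes identically on its own graph, so its Hessian does too. The vectors `(1,0)`,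
  -- `(0,1)`, `(1,1)` give every entry that the trace sees.
  have hquad : ∀ a b : ℝ, _ := fun a b => by
    have h1 := h.deriv_deriv_heightAbove hφ rfl rfl hβ (!₂[a, b] : E2)
    have h2 : deriv (deriv fun _ : ℝ => (0 : ℝ)) 0 = 0 := by simp
    rw [(hz _).deriv.deriv_eq, h2] at h1
    exact h1
  have h10 := hquad 1 0
  have h01 := hquad 0 1
  have h11 := hquad 1 1
  simp only [Matrix.cons_val_zero, Matrix.cons_val_one] at h10 h01 h11
  set k := restrictedHessian (Ψ y).1 c (partialAt 𝓘(ℝ, E2) Ψ y)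
      (fun i j => secondForm 𝓘(ℝ, E2) Ψ N y i j) β (deriv φ (lor (Ψ y).1 c ^ 2 - 1))
      (deriv (deriv φ) (lor (Ψ y).1 c ^ 2 - 1)) with hk
  have hk0 : gramTrace (partialAt 𝓘(ℝ, E2) Ψ y) k = 0 := by
    have k0 : k 0 0 = 0 := by linarith
    have k1 : k 1 1 = 0 := by linarith
    have k2 : k 0 1 + k 1 0 = 0 := by linarith
    simp [gramTrace, k0, k1, k2]
  have hβ0 : β ≠ 0 := left_ne_zero_of_mul_eq_one hβv
  rw [hk0, hφeq, mul_zero, mul_zero, sub_zero, zero_eq_mul] at htr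
  have h2 := htr.resolve_left (pow_ne_zero 2 hβ0)
  rw [meanCurvature_eq]
  refine mul_left_cancel₀ hβ0 ?_
  rw [hβv]
  linarith

end IsLocalSurface

end Flat

/-! ### Transfer to interior points of a surface with boundary -/

section Charts

variable {H : Type*} [TopologicalSpace H] {I : ModelWithCorners ℝ E2 H}
  {S : Type*} [TopologicalSpace S] [ChartedSpace H S]

lemma extChartAt_target_mem_nhds_of_range_mem_nhds {q : S} {y : E2}
    (hy : y ∈ (extChartAt I q).target) (hr : range I ∈ 𝓝 y) :
    (extChartAt I q).target ∈ 𝓝 y := by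
  have := extChartAt_target_mem_nhdsWithin_of_mem (I := I) hy
  rwa [nhdsWithin_eq_nhds.2 hr] at this

lemma fderiv_comp_extChartAt_symm [IsManifold I ∞ S] {f : S → L3R}
    (hf : ContMDiff I 𝓘(ℝ, L3R) ∞ f) {q : S} {y : E2} (hy : y ∈ (extChartAt I q).target)
    (hr : range I ∈ 𝓝 y) :
    ∃ L : E2 →L[ℝ] E2, Function.Injective L ∧ ∀ v, fderiv ℝ (f ∘ (extChartAt I q).symm) y v =
      (mfderiv I 𝓘(ℝ, L3R) f ((extChartAt I q).symm y) : E2 →L[ℝ] L3R) (L v) := by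
  have : IsManifold I 1 S := IsManifold.of_le (n := ∞) (by simp)
  have h1 : MDifferentiableWithinAt 𝓘(ℝ, E2) I (extChartAt I q).symm (range I) y :=
    mdifferentiableWithinAt_extChartAt_symm hy
  have h2 : MDifferentiableAt 𝓘(ℝ, E2) I (extChartAt I q).symm y := h1.mdifferentiableAt hr
  have h3 : MDifferentiableAt I 𝓘(ℝ, L3R) f ((extChartAt I q).symm y) :=
    (hf.mdifferentiable (by simp)) _
  have h4 := isInvertible_mfderivWithin_extChartAt_symm (I := I) hy
  rw [mfderivWithin_of_mem_nhds hr] at h4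
  refine ⟨mfderiv 𝓘(ℝ, E2) I (extChartAt I q).symm y, h4.injective, fun v => ?_⟩
  rw [← mfderiv_eq_fderiv, mfderiv_comp y h3 h2]
  rfl

lemma contDiffAt_comp_extChartAt_symm [IsManifold I ∞ S] {f : S → L3R}
    (hf : ContMDiff I 𝓘(ℝ, L3R) ∞ f) {q : S} {y : E2} (hy : y ∈ (extChartAt I q).target)
    (hr : range I ∈ 𝓝 y) : ContDiffAt ℝ ∞ (f ∘ (extChartAt I q).symm) y := by
  have h1 : ContMDiffAt 𝓘(ℝ, E2) I ∞ (extChartAt I q).symm y :=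
    (contMDiffWithinAt_extChartAt_symm_range q hy).contMDiffAt hr
  exact ((hf _).comp y h1).contDiffAt

/-- The manifold derivative is a derivative within `range I`; at an interior point this set is a
neighbourhood and the restriction disappears. -/
lemma partialAt_eq_model {f : S → L3R} (hf : ContMDiff I 𝓘(ℝ, L3R) ∞ f) {q : S}
    (hq : I.IsInteriorPoint q) : partialAt I f q =
      partialAt 𝓘(ℝ, E2) (f ∘ (extChartAt I q).symm) (extChartAt I q q) := by
  funext i
  have h3 : MDifferentiableAt I 𝓘(ℝ, L3R) f q := (hf.mdifferentiable (by simp)) _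
  rw [partialAt_model, partialAt, h3.mfderiv,
    fderivWithin_of_mem_nhds (range_mem_nhds_isInteriorPoint hq)]
  rfl

lemma prodForm_mfderiv_eq_zero {ψ η : S → L3R} (hη : IsUnitNormal I ψ η) (q : S) (v : E2) :
    prodForm ((mfderiv I 𝓘(ℝ, L3R) ψ q : E2 →L[ℝ] L3R) v) (η q) = 0 := by
  have h0 := hη.normal q 0
  have h1 := hη.normal q 1
  simp only [partialAt] at h0 h1
  have key : ∀ D : E2 →L[ℝ] L3R, prodForm (D (EuclideanSpace.single 0 1)) (η q) = 0 →
      prodForm (D (EuclideanSpace.single 1 1)) (η q) = 0 → prodForm (D v) (η q) = 0 := by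
    intro D h0 h1
    rw [exists_coords_E2 v, map_add, map_smul, map_smul, prodForm_add_left, prodForm_smul_left,
      prodForm_smul_left, h0, h1]
    ring
  exact key _ h0 h1

lemma IsOrientedSoliton.isLocalSurface [IsManifold I ∞ S] {ψ η : S → L3R}
    (h : IsOrientedSoliton I ψ η) {q : S} (hq : I.IsInteriorPoint q) :
    IsLocalSurface (ψ ∘ (extChartAt I q).symm) (η ∘ (extChartAt I q).symm)
      (extChartAt I q q) := by
  have hr := range_mem_nhds_isInteriorPoint hq
  have hy := mem_extChartAt_target (I := I) q
  have ht := extChartAt_target_mem_nhds_of_range_mem_nhds hy hr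
  refine ⟨(contDiffAt_comp_extChartAt_symm h.immersed.smooth hy hr).of_le ENat.LEInfty.out,
    (contDiffAt_comp_extChartAt_symm h.unitNormal.smooth hy hr).of_le (by simp),
    Filter.Eventually.of_forall fun x => (h.immersed.mem _).1, ?_, ?_, ?_, ?_⟩
  · filter_upwards [ht, eventually_mem_nhds_iff.2 hr] with x hx hx' v
    obtain ⟨L, -, hL⟩ := fderiv_comp_extChartAt_symm h.immersed.smooth hx hx'
    rw [hL]
    exact prodForm_mfderiv_eq_zero h.unitNormal _ _
  · exact h.unitNormal.tangent _
  · exact h.unitNormal.unit _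
  · obtain ⟨L, hLi, hL⟩ := fderiv_comp_extChartAt_symm h.immersed.smooth hy hr
    intro v w hvw
    rw [hL, hL] at hvw
    exact hLi (h.immersed.injective_mfderiv _ hvw)

lemma IsOrientedSoliton.meanCurvature_chart {ψ η : S → L3R}
    (h : IsOrientedSoliton I ψ η) {q : S} (hq : I.IsInteriorPoint q) :
    meanCurvature 𝓘(ℝ, E2) (ψ ∘ (extChartAt I q).symm) (η ∘ (extChartAt I q).symm)
      (extChartAt I q q) = prodForm (η q) vert := by
  rw [← h.equation q]
  simp only [meanCurvature, firstForm, secondForm]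
  rw [partialAt_eq_model h.immersed.smooth hq, partialAt_eq_model h.unitNormal.smooth hq]

/-- A soliton cannot touch a strict sub- or supersolution of the bowl equation at an interior
point, from the corresponding side. -/
lemma IsOrientedSoliton.mul_bowlOp_nonneg [IsManifold I ∞ S] {ψ η : S → L3R}
    (h : IsOrientedSoliton I ψ η) {q : S} (hq : I.IsInteriorPoint q) {φ : ℝ → ℝ} {c : L3}
    (hc : lor c c = -1) (hφ : ContDiffAt ℝ 2 φ (lor (ψ q).1 c ^ 2 - 1)) {δ : ℝ} (hδ : δ ≠ 0)
    (hmax : ∀ q', δ * heightAbove φ c (ψ q') ≤ δ * heightAbove φ c (ψ q)) :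
    0 ≤ δ * bowlOp (lor (ψ q).1 c ^ 2 - 1) (deriv φ (lor (ψ q).1 c ^ 2 - 1))
      (deriv (deriv φ) (lor (ψ q).1 c ^ 2 - 1)) := by
  have e : (extChartAt I q).symm (extChartAt I q q) = q := extChartAt_to_inv q
  have key := (h.isLocalSurface hq).mul_bowlOp_nonneg_of_isLocalMax (φ := φ) (c := c) (δ := δ)
    (by rw [h.meanCurvature_chart hq]; simp) hc (by simpa [e] using hφ) hδ
    (Filter.Eventually.of_forall fun x => by simpa [e] using hmax _)
  simpa [e] using key

end Charts

/-! ### Comparison of a compact soliton with the bowl -/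

/-- Reversed Cauchy–Schwarz: the tangential part `c + ⟨x, c⟩ x` of `c` has squared length `⟨x, c⟩² -
1`. It keeps the parameter `t` in the domain of the profile. -/
lemma one_le_lor_sq {x c : L3} (hx : lor x x = -1) (hc : lor c c = -1) : 1 ≤ lor x c ^ 2 := by
  have h1 : lor x (c + lor x c • x) = 0 := by
    rw [lor_add_right, lor_smul_right, hx]; ring
  have h2 := lor_self_nonneg hx h1
  simp only [lor_add_left, lor_add_right, lor_smul_left, lor_smul_right, hx, hc,
    lor_comm c x] at h2
  nlinarith

/-- `U` is the profile of the bowl soliton, as a function of `t = sinh² r`. -/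
def IsBowlProfile (U : ℝ → ℝ) : Prop :=
  ∀ t, 0 ≤ t → ContDiffAt ℝ ∞ U t ∧ bowlOp t (deriv U t) (deriv (deriv U) t) = 0

lemma exists_isBowlProfile : ∃ U, IsBowlProfile U := exists_bowl_profile

lemma IsBowlProfile.perturb {U : ℝ → ℝ} (hU : IsBowlProfile U) {t : ℝ} (ht : 0 ≤ t) (ε : ℝ) :
    ContDiffAt ℝ 2 (fun t => U t + ε * t) t ∧
    ∃ m, 0 < m ∧ bowlOp t (deriv (fun t => U t + ε * t) t)
      (deriv (deriv fun t => U t + ε * t) t) = ε * m := by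
  obtain ⟨h1, h2⟩ := hU t ht
  have h3 : ContDiffAt ℝ 2 U t := h1.of_le ENat.LEInfty.out
  refine ⟨h3.add (contDiffAt_const.mul contDiffAt_id), ?_⟩
  obtain ⟨m, hm, he⟩ := bowlOp_perturb ht (deriv U t) (deriv (deriv U) t) ε
  refine ⟨m, hm, ?_⟩
  have hd : deriv (fun t => U t + ε * t) =ᶠ[𝓝 t] fun t => deriv U t + ε := by
    filter_upwards [h3.eventually (by simp)] with s hs
    have := (hs.differentiableAt (by simp)).hasDerivAt.add ((hasDerivAt_id s).const_mul ε)
    rw [mul_one] at this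
    exact this.deriv
  rw [hd.deriv_eq, hd.self_of_nhds, deriv_add_const, he, h2, zero_add]

section Comparison

variable {H : Type*} [TopologicalSpace H] {I : ModelWithCorners ℝ E2 H}
  {S : Type*} [TopologicalSpace S] [ChartedSpace H S] [IsManifold I ∞ S] [CompactSpace S]

/-- The maximum principle; the sign of `δ` selects the upper or the lower bound. -/
lemma IsOrientedSoliton.mul_heightAbove_le {ψ η : S → L3R} (h : IsOrientedSoliton I ψ η)
    {U : ℝ → ℝ} (hU : IsBowlProfile U) {c : L3} (hc : lor c c = -1) {l h₀ : ℝ}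
    (hbd : ∀ q ∈ I.boundary S, heightAbove U c (ψ q) = h₀ ∧ lor (ψ q).1 c ^ 2 - 1 = l)
    {δ : ℝ} (hδ : δ ≠ 0) (q : S) : δ * heightAbove U c (ψ q) ≤ δ * h₀ := by
  have ht : ∀ q, 0 ≤ lor (ψ q).1 c ^ 2 - 1 := fun q =>
    sub_nonneg.2 (one_le_lor_sq (h.immersed.mem q).1 hc)
  have hψ : Continuous ψ := h.immersed.smooth.continuous
  have hlc : Continuous fun q => lor (ψ q).1 c ^ 2 - 1 := by
    simp only [lor]; fun_prop
  have key : ∀ s : ℝ, 0 < s → δ * heightAbove U c (ψ q) + s * δ ^ 2 * (lor (ψ q).1 c ^ 2 - 1) ≤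
      δ * h₀ + s * δ ^ 2 * l := by
    intro s hs
    -- For this `φ`, `δ * bowlOp = -s δ² m < 0`, which is incompatible with an interior maximum of
    -- `δ` times the height above `φ`.
    set φ : ℝ → ℝ := fun t => U t + -s * δ * t with hφ
    have hcont : Continuous fun q => δ * heightAbove φ c (ψ q) := by
      refine continuous_const.mul (hψ.snd.sub ?_)
      rw [continuous_iff_continuousAt]
      intro q
      exact ContinuousAt.comp (g := φ) ((hU.perturb (ht q) _).1.continuousAt) hlc.continuousAt
    obtain ⟨q₁, -, hq₁⟩ := isCompact_univ.exists_isMaxOn ⟨q, mem_univ q⟩ hcont.continuousOn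
    have hq₁' : ∀ q', δ * heightAbove φ c (ψ q') ≤ δ * heightAbove φ c (ψ q₁) :=
      fun q' => hq₁ (mem_univ q')
    have hexp : ∀ q, δ * heightAbove φ c (ψ q) =
        δ * heightAbove U c (ψ q) + s * δ ^ 2 * (lor (ψ q).1 c ^ 2 - 1) := by
      intro q
      simp only [heightAbove, hφ]
      ring
    by_cases hb : q₁ ∈ I.boundary S
    · have := hq₁' q
      rw [hexp, hexp, (hbd q₁ hb).1, (hbd q₁ hb).2] at this
      exact this
    · exfalso
      have hint : I.IsInteriorPoint q₁ := by
        rcases I.isInteriorPoint_or_isBoundaryPoint q₁ with h | h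
        · exact h
        · exact absurd h hb
      obtain ⟨hc2, m, hm, he⟩ := hU.perturb (ht q₁) (-s * δ)
      have := h.mul_bowlOp_nonneg hint hc hc2 hδ hq₁'
      rw [he] at this
      have hpos : 0 < s * δ ^ 2 * m := by positivity
      nlinarith
  -- The perturbation is removed by `s → 0`; its contribution on the left is nonnegative and can be
  -- dropped.
  have hlim : ∀ A : ℝ, Filter.Tendsto (fun s : ℝ => A + s * δ ^ 2 * l) (𝓝[>] 0) (𝓝 A) := by
    intro A
    have : Continuous fun s : ℝ => A + s * δ ^ 2 * l := by fun_prop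
    simpa using (this.tendsto 0).mono_left nhdsWithin_le_nhds
  refine ge_of_tendsto (hlim (δ * h₀)) ?_
  filter_upwards [self_mem_nhdsWithin] with s hs
  have := key s hs
  have hpos : 0 ≤ s * δ ^ 2 * (lor (ψ q).1 c ^ 2 - 1) :=
    mul_nonneg (mul_nonneg (le_of_lt hs) (sq_nonneg _)) (ht q)
  linarith

/-- A compact soliton whose boundary is a horizontal circle lies on a translated bowl soliton. -/
lemma IsOrientedSoliton.heightAbove_eq {ψ η : S → L3R} (h : IsOrientedSoliton I ψ η)
    {U : ℝ → ℝ} (hU : IsBowlProfile U) {c : L3} (hc : lor c c = -1) {l h₀ : ℝ}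
    (hbd : ∀ q ∈ I.boundary S, heightAbove U c (ψ q) = h₀ ∧ lor (ψ q).1 c ^ 2 - 1 = l) (q : S) :
    heightAbove U c (ψ q) = h₀ := by
  have h1 := h.mul_heightAbove_le hU hc hbd one_ne_zero q
  have h2 := h.mul_heightAbove_le hU hc hbd (neg_ne_zero.2 one_ne_zero) q
  linarith

end Comparison

/-! ### The hyperboloid under Lorentz maps -/

lemma origin_mem_H2 : origin ∈ H2 := by simp [H2, origin, lor]

lemma lor_origin (x : L3) : lor x origin = -x 2 := by simp [lor, origin]

lemma lor_neg_of_mem {x c : L3} (hx : x ∈ H2) (hc : c ∈ H2) : lor x c < 0 := by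
  obtain ⟨hx1, hx2⟩ := hx
  obtain ⟨hc1, hc2⟩ := hc
  simp only [lor] at *
  have h1 : (x 0 * c 0 + x 1 * c 1) ^ 2 < (x 2 * c 2) ^ 2 := by
    nlinarith [sq_nonneg (x 0 * c 1 - x 1 * c 0), sq_nonneg (x 0), sq_nonneg (x 1),
      sq_nonneg (c 0), sq_nonneg (c 1)]
  have := abs_lt_of_sq_lt_sq h1 (by positivity)
  linarith [(abs_lt.1 this).2]

/-- The condition `0 < x 2` is replaced by one that refers to any chosen point of `ℍ²`, so that
Lorentz maps moving the origin can be handled. -/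
lemma mem_H2_iff {x c : L3} (hc : c ∈ H2) : x ∈ H2 ↔ lor x x = -1 ∧ lor x c < 0 := by
  refine ⟨fun hx => ⟨hx.1, lor_neg_of_mem hx hc⟩, fun ⟨h1, h2⟩ => ⟨h1, ?_⟩⟩
  by_contra hneg
  have h3 : x 2 ≠ 0 := by
    intro h0
    simp only [lor, h0] at h1
    nlinarith [sq_nonneg (x 0), sq_nonneg (x 1)]
  have hm : (-1 : ℝ) • x ∈ H2 := by
    refine ⟨by rw [lor_smul_left, lor_smul_right, h1]; ring, ?_⟩
    have := lt_of_le_of_ne (not_lt.1 hneg) h3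
    simpa using this
  have := lor_neg_of_mem hm hc
  rw [lor_smul_left] at this
  linarith

lemma coord_two_of_mem_H2 {x : L3} (hx : x ∈ H2) : x 2 = √(1 + x 0 ^ 2 + x 1 ^ 2) := by
  obtain ⟨h1, h2⟩ := hx
  simp only [lor] at h1
  rw [eq_comm, Real.sqrt_eq_iff_mul_self_eq (by positivity) h2.le]
  linarith

lemma injective_of_lor_map {A : L3 →ₗ[ℝ] L3} (hA : ∀ x y, lor (A x) (A y) = lor x y) :
    Function.Injective A := by
  rw [← LinearMap.ker_eq_bot, LinearMap.ker_eq_bot']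
  intro x hx
  have h : ∀ y, lor x y = 0 := fun y => by rw [← hA, hx]; simp [lor]
  ext i
  have h0 := h (Pi.single i 1)
  fin_cases i <;> simpa [lor] using h0

lemma surjective_of_lor_map {A : L3 →ₗ[ℝ] L3} (hA : ∀ x y, lor (A x) (A y) = lor x y) :
    Function.Surjective A :=
  LinearMap.injective_iff_surjective.1 (injective_of_lor_map hA)

lemma map_mem_H2_iff {A : L3 →ₗ[ℝ] L3} (hA : ∀ x y, lor (A x) (A y) = lor x y) {c d : L3}
    (hc : c ∈ H2) (hd : d ∈ H2) (hcd : A c = d) (x : L3) : A x ∈ H2 ↔ x ∈ H2 := by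
  rw [mem_H2_iff hd, mem_H2_iff hc, hA, ← hcd, hA]

/-- A set described by the distance to the axis and the height is rotationally invariant. -/
lemma rotInvariant_setOf {c : L3} (hc : c ∈ H2) (Q : ℝ → ℝ → Prop) :
    RotInvariant c {P : L3R | P.1 ∈ H2 ∧ Q (lor P.1 c) P.2} := by
  intro A hA
  have hm := map_mem_H2_iff hA.lor_map hc hc hA.map_center
  have hl : ∀ x, lor (A x) c = lor x c := fun x => by
    rw [← hA.lor_map x c, hA.map_center]
  ext P
  constructor
  · rintro ⟨P, ⟨h1, h2⟩, rfl⟩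
    exact ⟨(hm _).2 h1, by simpa only [hl] using h2⟩
  · rintro ⟨h1, h2⟩
    obtain ⟨x, hx⟩ := surjective_of_lor_map hA.lor_map P.1
    refine ⟨(x, P.2), ⟨(hm _).1 (hx ▸ h1), ?_⟩, Prod.ext hx rfl⟩
    simpa only [← hx, hl] using h2

/-! ### The graph of the profile is a bowl soliton -/

section Bowl

variable {U : ℝ → ℝ}

/-- The height function of the graph of a rotationally symmetric function. -/
def radialHeight (U : ℝ → ℝ) (x : E2) : ℝ := U (x 0 ^ 2 + x 1 ^ 2)

lemma graphMap_fst_mem (u : E2 → ℝ) (x : E2) : (graphMap u x).1 ∈ H2 := by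
  have h : 0 ≤ 1 + x 0 ^ 2 + x 1 ^ 2 := by positivity
  refine ⟨?_, ?_⟩
  · simp only [lor, graphMap, Matrix.cons_val_zero, Matrix.cons_val_one, Matrix.cons_val,
      Real.mul_self_sqrt h]
    ring
  · simp only [graphMap, Matrix.cons_val]
    positivity

lemma lor_graphMap_origin_sq (u : E2 → ℝ) (x : E2) :
    lor (graphMap u x).1 origin ^ 2 - 1 = x 0 ^ 2 + x 1 ^ 2 := by
  have h : 0 ≤ 1 + x 0 ^ 2 + x 1 ^ 2 := by positivity
  rw [lor_origin]
  simp only [graphMap, Matrix.cons_val, neg_sq, Real.sq_sqrt h]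
  ring

lemma heightAbove_graphMap (U : ℝ → ℝ) (x : E2) :
    heightAbove U origin (graphMap (radialHeight U) x) = 0 := by
  rw [heightAbove, lor_graphMap_origin_sq]
  exact sub_self _

lemma range_graphMap_radialHeight (U : ℝ → ℝ) : range (graphMap (radialHeight U)) =
    {P : L3R | P.1 ∈ H2 ∧ heightAbove U origin P = 0} := by
  ext P
  constructor
  · rintro ⟨x, rfl⟩
    exact ⟨graphMap_fst_mem _ _, heightAbove_graphMap U x⟩
  · rintro ⟨h1, h2⟩
    have hfst : (graphMap (radialHeight U) !₂[P.1 0, P.1 1]).1 = P.1 := by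
      ext i
      fin_cases i
      · simp [graphMap]
      · simp [graphMap]
      · simp [graphMap, ← coord_two_of_mem_H2 h1]
    refine ⟨!₂[P.1 0, P.1 1], Prod.ext hfst ?_⟩
    have h3 := heightAbove_graphMap U !₂[P.1 0, P.1 1]
    rw [heightAbove, hfst] at h3
    rw [heightAbove] at h2
    linarith

lemma IsBowlProfile.contDiffAt_deriv (hU : IsBowlProfile U) {t : ℝ} (ht : 0 ≤ t) :
    ContDiffAt ℝ ∞ (deriv U) t :=
  ((hU t ht).1.fderiv_right (m := ∞) le_rfl).clm_apply contDiffAt_const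

lemma contDiff_sq_add_sq : ContDiff ℝ ∞ fun x : E2 => x 0 ^ 2 + x 1 ^ 2 := by fun_prop

lemma sq_add_sq_nonneg' (x : E2) : 0 ≤ x 0 ^ 2 + x 1 ^ 2 := by positivity

lemma IsBowlProfile.contDiff_graphMap (hU : IsBowlProfile U) :
    ContDiff ℝ ∞ (graphMap (radialHeight U)) := by
  refine ContDiff.prodMk ?_ ?_
  · rw [contDiff_pi]
    intro i
    fin_cases i
    · simp only [Fin.zero_eta, Matrix.cons_val_zero]; fun_prop
    · simp only [Fin.mk_one, Matrix.cons_val_one, Matrix.cons_val_zero]; fun_prop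
    · simp only [Fin.reduceFinMk, Matrix.cons_val]
      refine ContDiff.sqrt (by fun_prop) fun x => ?_
      positivity
  · rw [contDiff_iff_contDiffAt]
    intro x
    exact (hU _ (sq_add_sq_nonneg' x)).1.comp x contDiff_sq_add_sq.contDiffAt

/-- The length of the gradient of the height above the bowl soliton. -/
def bowlW (U : ℝ → ℝ) (x : E2) : ℝ :=
  √(1 + 4 * deriv U (x 0 ^ 2 + x 1 ^ 2) ^ 2 * (1 + (x 0 ^ 2 + x 1 ^ 2)) * (x 0 ^ 2 + x 1 ^ 2))

lemma bowlW_arg_pos (U : ℝ → ℝ) (x : E2) : 0 < 1 + 4 * deriv U (x 0 ^ 2 + x 1 ^ 2) ^ 2 *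
    (1 + (x 0 ^ 2 + x 1 ^ 2)) * (x 0 ^ 2 + x 1 ^ 2) := by positivity

lemma bowlW_pos (U : ℝ → ℝ) (x : E2) : 0 < bowlW U x := Real.sqrt_pos.2 (bowlW_arg_pos U x)

/-- The upwards unit normal of the bowl soliton. -/
def bowlNormal (U : ℝ → ℝ) (x : E2) : L3R :=
  (bowlW U x)⁻¹ • heightGradient (graphMap (radialHeight U) x).1 origin
    (deriv U (x 0 ^ 2 + x 1 ^ 2))

lemma ContDiff.lor {f g : E2 → L3} (hf : ContDiff ℝ ∞ f) (hg : ContDiff ℝ ∞ g) :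
    ContDiff ℝ ∞ fun x => lor (f x) (g x) := by
  have hf' := contDiff_pi.1 hf
  have hg' := contDiff_pi.1 hg
  exact (((hf' 0).mul (hg' 0)).add ((hf' 1).mul (hg' 1))).sub ((hf' 2).mul (hg' 2))

lemma IsBowlProfile.contDiff_bowlNormal (hU : IsBowlProfile U) :
    ContDiff ℝ ∞ (bowlNormal U) := by
  have hp : ContDiff ℝ ∞ fun x : E2 => deriv U (x 0 ^ 2 + x 1 ^ 2) := by
    rw [contDiff_iff_contDiffAt]
    intro x
    exact (hU.contDiffAt_deriv (sq_add_sq_nonneg' x)).comp x contDiff_sq_add_sq.contDiffAt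
  have hX : ContDiff ℝ ∞ fun x : E2 => (graphMap (radialHeight U) x).1 :=
    contDiff_fst.comp hU.contDiff_graphMap
  have ht := contDiff_sq_add_sq
  have hW : ContDiff ℝ ∞ (bowlW U) := by
    refine ContDiff.sqrt ?_ fun x => (bowlW_arg_pos U x).ne'
    fun_prop
  have hl := hX.lor (contDiff_const (c := origin))
  refine (hW.inv fun x => (bowlW_pos U x).ne').smul (ContDiff.prodMk ?_ contDiff_const)
  exact ((contDiff_const.mul hp).mul hl).smul (contDiff_const.add (hl.smul hX))

/-- The first two coordinates of the graph map are `x` itself. -/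
lemma IsBowlProfile.injective_fderiv_graphMap (hU : IsBowlProfile U) (x : E2) :
    Function.Injective (fderiv ℝ (graphMap (radialHeight U)) x) := by
  have hd : HasFDerivAt (graphMap (radialHeight U)) _ x :=
    (hU.contDiff_graphMap.differentiable (by simp) x).hasFDerivAt
  have key : ∀ (i : Fin 2) (j : Fin 3), (∀ y, (graphMap (radialHeight U) y).1 j = y i) →
      ∀ v, (fderiv ℝ (graphMap (radialHeight U)) x v).1 j = v i := by
    intro i j hij v
    have h1 := ((ContinuousLinearMap.proj (R := ℝ) (φ := fun _ : Fin 3 => ℝ) j).comp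
      (ContinuousLinearMap.fst ℝ L3 ℝ)).hasFDerivAt.comp x hd
    have h2 : ((ContinuousLinearMap.proj (R := ℝ) (φ := fun _ : Fin 3 => ℝ) j).comp
      (ContinuousLinearMap.fst ℝ L3 ℝ)) ∘ graphMap (radialHeight U) =
      EuclideanSpace.proj (𝕜 := ℝ) i := funext hij
    rw [h2] at h1
    exact congrArg (fun L : E2 →L[ℝ] ℝ => L v)
      (h1.unique (EuclideanSpace.proj (𝕜 := ℝ) i).hasFDerivAt)
  intro v w hvw
  ext i
  fin_cases i
  · have := congrArg (fun V : L3R => V.1 0) hvw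
    simp only [key 0 0 fun y => rfl] at this
    exact this
  · have := congrArg (fun V : L3R => V.1 1) hvw
    simp only [key 1 1 fun y => rfl] at this
    exact this

lemma IsBowlProfile.isLocalSurface (hU : IsBowlProfile U) (x : E2) :
    IsLocalSurface (graphMap (radialHeight U)) (bowlNormal U) x where
  smooth := hU.contDiff_graphMap.contDiffAt.of_le ENat.LEInfty.out
  smooth_normal := hU.contDiff_bowlNormal.contDiffAt.of_le (by simp)
  mem := Filter.Eventually.of_forall fun x => (graphMap_fst_mem _ x).1
  normal := Filter.Eventually.of_forall fun x v => by
    have h := heightGradient_orthogonal (Ψ := graphMap (radialHeight U)) (y := x) (c := origin)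
      (φ := U) (v := v)
      (hU.contDiff_graphMap.contDiffAt.of_le ENat.LEInfty.out)
      (Filter.Eventually.of_forall fun x => (graphMap_fst_mem _ x).1)
      (p := deriv U (x 0 ^ 2 + x 1 ^ 2))
      (by
        rw [lor_graphMap_origin_sq]
        exact ((hU _ (sq_add_sq_nonneg' x)).1.differentiableAt (by simp)).hasDerivAt)
      (by simp only [heightAbove_graphMap, deriv_const])
    rw [prodForm_comm, bowlNormal, prodForm_smul_left, h, mul_zero]
  tangent := by
    rw [bowlNormal, Prod.smul_fst, lor_smul_right,
      lor_heightGradient (graphMap_fst_mem _ x).1, mul_zero]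
  unit := by
    rw [bowlNormal, prodForm_smul_left, prodForm_smul_right,
      prodForm_heightGradient_self (graphMap_fst_mem _ x).1 origin_mem_H2.1]
    have e := lor_graphMap_origin_sq (radialHeight U) x
    have e1 : lor (graphMap (radialHeight U) x).1 origin ^ 2 = 1 + (x 0 ^ 2 + x 1 ^ 2) := by
      linarith
    rw [e1, add_sub_cancel_left, ← Real.sq_sqrt (bowlW_arg_pos U x).le, ← bowlW]
    have := (bowlW_pos U x).ne'
    field_simp
  injective := hU.injective_fderiv_graphMap x

lemma IsBowlProfile.isOrientedSoliton (hU : IsBowlProfile U) :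
    IsOrientedSoliton 𝓘(ℝ, E2) (graphMap (radialHeight U)) (bowlNormal U) where
  immersed :=
    { mem := graphMap_fst_mem _
      smooth := hU.contDiff_graphMap.contMDiff
      injective_mfderiv := fun x => by
        rw [mfderiv_eq_fderiv]
        exact hU.injective_fderiv_graphMap x }
  unitNormal :=
    { smooth := hU.contDiff_bowlNormal.contMDiff
      tangent := fun x => (hU.isLocalSurface x).tangent
      normal := fun x i => (hU.isLocalSurface x).isSurfaceFrame.normal i
      unit := fun x => (hU.isLocalSurface x).unit }
  equation := fun x => by
    refine (hU.isLocalSurface x).meanCurvature_of_graph (φ := U) origin_mem_H2.1 ?_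
      (Filter.Eventually.of_forall fun x => heightAbove_graphMap U x) ?_
    · rw [lor_graphMap_origin_sq]
      exact (hU _ (sq_add_sq_nonneg' x)).1.of_le ENat.LEInfty.out
    · rw [lor_graphMap_origin_sq]
      exact (hU _ (sq_add_sq_nonneg' x)).2

lemma IsBowlProfile.isBowlSoliton (hU : IsBowlProfile U) :
    IsBowlSoliton {P : L3R | P.1 ∈ H2 ∧ heightAbove U origin P = 0} := by
  refine ⟨radialHeight U, (range_graphMap_radialHeight U).symm,
    rotInvariant_setOf origin_mem_H2 fun a z => z - U (a ^ 2 - 1) = 0, bowlNormal U,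
    hU.isOrientedSoliton, fun x => ?_⟩
  rw [bowlNormal, prodForm_smul_left]
  have : prodForm (heightGradient (graphMap (radialHeight U) x).1 origin
      (deriv U (x 0 ^ 2 + x 1 ^ 2))) vert = 1 := by
    simp [heightGradient, prodForm, vert, lor]
  rw [this, mul_one]
  exact inv_pos.2 (bowlW_pos U x)

end Bowl

/-! ### Boosts, rotations and rotationally invariant curves -/

lemma continuous_circle_coe : Continuous fun z : Circle => (z : ℂ) := by fun_prop

/-- A continuous injective map of the circle into itself is surjective. -/
lemma Circle.surjective_of_injective {f : Circle → Circle} (hf : Continuous f)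
    (hi : Function.Injective f) : Function.Surjective f := by
  by_contra hs
  obtain ⟨p, hp⟩ := not_forall.1 hs
  -- The missed point `p` is rotated to `-1`, where the argument jumps; off it, `arg` turns the map
  -- into a continuous injection of the circle into `ℝ`.
  set w : Circle → Circle := fun z => Circle.exp Real.pi * (f z * p⁻¹) with hw
  have hwi : Function.Injective w := fun a b hab =>
    hi (mul_right_cancel (mul_left_cancel hab))
  have hwc : Continuous w := continuous_const.mul (hf.mul continuous_const)
  have hpi : ((Circle.exp Real.pi : Circle) : ℂ) = -1 := by simp [Circle.coe_exp]
  have hslit : ∀ z, (w z : ℂ) ∈ Complex.slitPlane := by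
    intro z
    rw [Complex.mem_slitPlane_iff_arg]
    refine ⟨fun h => hp ⟨z, ?_⟩, Circle.coe_ne_zero _⟩
    have h1 : (w z : ℂ) = -1 := by
      have := Complex.norm_mul_exp_arg_mul_I (w z : ℂ)
      rw [h, Circle.norm_coe] at this
      simpa using this.symm
    rw [hw, Circle.coe_mul, hpi, Circle.coe_mul] at h1
    have h2 : (f z * p⁻¹ : Circle) = 1 := by
      ext
      rw [Circle.coe_mul, Circle.coe_one]
      linear_combination -h1
    exact mul_inv_eq_one.1 h2
  set g : Circle → ℝ := fun z => Complex.arg (w z) with hg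
  have hgc : Continuous g := by
    rw [continuous_iff_continuousAt]
    intro z
    exact ContinuousAt.comp (f := fun z => (w z : ℂ)) (Complex.continuousAt_arg (hslit z))
      (continuous_circle_coe.comp hwc).continuousAt
  have hgi : Function.Injective g := fun a b hab => hwi (Circle.injective_arg hab)
  -- Borsuk–Ulam in dimension one: `k` is odd under the antipodal map, so it has a zero, and there
  -- `g` identifies antipodal points.
  set k : Circle → ℝ := fun z => g z - g (Circle.exp Real.pi * z) with hk
  have hkc : Continuous k := hgc.sub (hgc.comp (continuous_const.mul continuous_id))
  have hee : ∀ z : Circle, Circle.exp Real.pi * (Circle.exp Real.pi * z) = z := by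
    intro z
    ext
    rw [Circle.coe_mul, Circle.coe_mul, hpi]
    ring
  have hanti : k (Circle.exp Real.pi * 1) = -k 1 := by
    simp only [hk, hee]
    ring
  have hex : ∃ z, k z = 0 := by
    have hkc' : Continuous (k ∘ Circle.exp) := hkc.comp Circle.exp.continuous
    have h1 : (k ∘ Circle.exp) 0 = k 1 := by simp
    have h2 : (k ∘ Circle.exp) Real.pi = -k 1 := by
      rw [← hanti, mul_one]; rfl
    have : (0 : ℝ) ∈ range (k ∘ Circle.exp) := by
      rcases le_total (k 1) 0 with h | h
      · exact mem_range_of_exists_le_of_exists_ge hkc' ⟨0, by rw [h1]; exact h⟩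
          ⟨Real.pi, by rw [h2]; linarith⟩
      · exact mem_range_of_exists_le_of_exists_ge hkc' ⟨Real.pi, by rw [h2]; linarith⟩
          ⟨0, by rw [h1]; exact h⟩
    obtain ⟨t, ht⟩ := this
    exact ⟨_, ht⟩
  obtain ⟨z, hz⟩ := hex
  have h1 : z = Circle.exp Real.pi * z := hgi (sub_eq_zero.1 hz)
  have h2 := congrArg (fun z : Circle => (z : ℂ)) h1
  simp only [Circle.coe_mul, hpi] at h2
  exact Circle.coe_ne_zero z (by linear_combination h2 / 2)

/-- The hyperbolic translation along the geodesic through `c` and the origin that moves `c` to the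
origin. -/
def boost (c : L3) : L3 →ₗ[ℝ] L3 where
  toFun x := x + (lor x (c + origin) / (1 - lor c origin)) • (c + origin) -
    (2 * lor x c) • origin
  map_add' x y := by
    simp only [lor_add_left, add_div, mul_add, add_smul]
    abel
  map_smul' r x := by
    simp only [lor_smul_left, RingHom.id_apply, smul_sub, smul_add, smul_smul, mul_div_assoc]
    rw [mul_left_comm]

lemma boost_apply (c x : L3) : boost c x = x +
    (lor x (c + origin) / (1 - lor c origin)) • (c + origin) - (2 * lor x c) • origin := rfl

lemma boost_lor_map {c : L3} (hc : c ∈ H2) (x y : L3) :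
    lor (boost c x) (boost c y) = lor x y := by
  have h1 : 1 - lor c origin ≠ 0 := by linarith [lor_neg_of_mem hc origin_mem_H2]
  have h2 := hc.1
  have h3 := origin_mem_H2.1
  simp only [boost_apply, lor_add_left, lor_add_right, lor_sub_left, lor_sub_right, lor_smul_left,
    lor_smul_right, h2, h3, lor_comm origin c, lor_comm c y, lor_comm origin y]
  field_simp
  ring

lemma boost_self {c : L3} (hc : c ∈ H2) : boost c c = origin := by
  have h1 : 1 - lor c origin ≠ 0 := by linarith [lor_neg_of_mem hc origin_mem_H2]
  have h2 : lor c (c + origin) / (1 - lor c origin) = -1 := by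
    rw [lor_add_right, hc.1, div_eq_iff h1]; ring
  rw [boost_apply, h2, hc.1]
  module

lemma neg_lor_gt_one {x c : L3} (hx : x ∈ H2) (hc : c ∈ H2) (h : x ≠ c) : 1 < -lor x c := by
  have h1 := lor_neg_of_mem hx hc
  have h0 : lor x (c + lor x c • x) = 0 := by
    rw [lor_add_right, lor_smul_right, hx.1]; ring
  have hne : c + lor x c • x ≠ 0 := by
    intro hz
    have h2 : c = (-lor x c) • x := by rw [neg_smul]; exact eq_neg_of_add_eq_zero_left hz
    have h3 : lor c c = (-lor x c) ^ 2 * lor x x := by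
      nth_rewrite 1 [h2]
      nth_rewrite 2 [h2]
      rw [lor_smul_left, lor_smul_right]
      ring
    rw [hx.1, hc.1] at h3
    have h4 : -lor x c = 1 := by nlinarith
    rw [h4, one_smul] at h2
    exact h h2.symm
  have h2 := lor_self_pos hx.1 h0 hne
  simp only [lor_add_left, lor_add_right, lor_smul_left, lor_smul_right, hx.1, hc.1,
    lor_comm c x] at h2
  nlinarith

/-- For `c` off the origin the geodesic starts at `c` with unit direction `(origin - k c) / r` and
the shift is `arcosh k`, the distance to the origin. For `c = origin` the boost is the identity, a
translation by `0` along any geodesic. -/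
lemma boost_isHypTranslation {c : L3} (hc : c ∈ H2) : IsHypTranslation (boost c) := by
  by_cases hco : c = origin
  · have hid : ∀ x, boost c x = x := by
      intro x
      have h1 : lor x (origin + origin) / (1 - lor origin origin) = lor x origin := by
        rw [lor_add_right, origin_mem_H2.1]; ring
      rw [boost_apply, hco, h1]
      module
    refine ⟨origin, origin_mem_H2, ![1, 0, 0], by simp [lor], by simp [lor, origin], 0, ?_, ?_,
      fun w _ _ => hid w⟩
    · simp [hid]
    · simp [hid]
  · set k := -lor c origin with hk
    have hk1 : 1 < k := neg_lor_gt_one hc origin_mem_H2 hco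
    have hd : 1 - lor c origin ≠ 0 := by linarith
    have hlo : lor c origin = -k := by rw [hk, neg_neg]
    have hs : 0 < k ^ 2 - 1 := by nlinarith
    set r := √(k ^ 2 - 1) with hr
    have hr0 : 0 < r := Real.sqrt_pos.2 hs
    have hrr : r ^ 2 = k ^ 2 - 1 := Real.sq_sqrt hs.le
    have hbo : boost c origin = (2 * k) • origin - c := by
      have h2 : lor origin (c + origin) / (1 - lor c origin) = -1 := by
        rw [lor_add_right, origin_mem_H2.1, div_eq_iff hd, lor_comm origin c]; ring
      rw [boost_apply, h2, lor_comm origin c, hlo]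
      module
    refine ⟨c, hc, r⁻¹ • (origin - k • c), ?_, ?_, Real.arcosh k, ?_, ?_, ?_⟩
    · simp only [lor_smul_left, lor_smul_right, lor_sub_left, lor_sub_right, hc.1,
        origin_mem_H2.1, lor_comm origin c, hlo]
      field_simp
      linarith
    · simp only [lor_smul_right, lor_sub_right, hc.1, hlo]
      ring
    · rw [boost_self hc, Real.cosh_arcosh hk1.le, Real.sinh_arcosh hk1.le, ← hr, smul_smul,
        mul_inv_cancel₀ hr0.ne']
      module
    · rw [map_smul, map_sub, map_smul, hbo, boost_self hc, Real.cosh_arcosh hk1.le,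
        Real.sinh_arcosh hk1.le, ← hr, smul_comm k]
      have e : r • c = r⁻¹ • ((k ^ 2 - 1) • c) := by
        rw [← hrr, smul_smul]
        congr 1
        field_simp
      rw [e, ← smul_add]
      congr 1
      module
    · intro w hw1 hw2
      rw [lor_smul_left, lor_sub_left, lor_smul_left, hw1] at hw2
      have hw3 : lor origin w = 0 := by
        have := (mul_eq_zero.1 hw2).resolve_left (inv_ne_zero hr0.ne')
        linarith
      rw [boost_apply, lor_add_right, lor_comm w c, lor_comm w origin, hw1, hw3]
      simp

/-- The rotation around the origin of `ℍ²` by `z`. -/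
def rotOrigin (z : Circle) : L3 →ₗ[ℝ] L3 :=
  Matrix.toLin' !![(z : ℂ).re, -(z : ℂ).im, 0; (z : ℂ).im, (z : ℂ).re, 0; 0, 0, 1]

lemma rotOrigin_apply (z : Circle) (x : L3) : rotOrigin z x =
    ![(z : ℂ).re * x 0 - (z : ℂ).im * x 1, (z : ℂ).im * x 0 + (z : ℂ).re * x 1, x 2] := by
  rw [rotOrigin, Matrix.toLin'_apply]
  ext i
  fin_cases i <;> simp [Matrix.mulVec, dotProduct, Fin.sum_univ_three]
  ring

lemma Circle.re_sq_add_im_sq (z : Circle) : (z : ℂ).re ^ 2 + (z : ℂ).im ^ 2 = 1 := by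
  have := Circle.normSq_coe z
  rw [Complex.normSq_apply] at this
  linarith

lemma rotOrigin_isRotationAbout (z : Circle) : IsRotationAbout origin (rotOrigin z) where
  lor_map x y := by
    have h := Circle.re_sq_add_im_sq z
    simp only [rotOrigin_apply, lor, Matrix.cons_val_zero, Matrix.cons_val_one, Matrix.cons_val]
    linear_combination (x 0 * y 0 + x 1 * y 1) * h
  det_eq := by
    have h := Circle.re_sq_add_im_sq z
    rw [rotOrigin, LinearMap.det_toLin', Matrix.det_fin_three]
    simp
    linarith
  map_center := by
    rw [rotOrigin_apply]
    ext i
    fin_cases i <;> simp [origin]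

/-- The boost as a linear equivalence. -/
def boostEquiv {c : L3} (hc : c ∈ H2) : L3 ≃ₗ[ℝ] L3 :=
  LinearEquiv.ofBijective (boost c)
    ⟨injective_of_lor_map (boost_lor_map hc), surjective_of_lor_map (boost_lor_map hc)⟩

lemma boostEquiv_apply {c : L3} (hc : c ∈ H2) (x : L3) : boostEquiv hc x = boost c x := rfl

/-- The rotation around `c` by `z`. -/
def rotAbout {c : L3} (hc : c ∈ H2) (z : Circle) : L3 →ₗ[ℝ] L3 :=
  (boostEquiv hc).symm.toLinearMap ∘ₗ rotOrigin z ∘ₗ (boostEquiv hc).toLinearMap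

lemma rotAbout_apply {c : L3} (hc : c ∈ H2) (z : Circle) (x : L3) :
    rotAbout hc z x = (boostEquiv hc).symm (rotOrigin z (boost c x)) := rfl

lemma rotAbout_isRotationAbout {c : L3} (hc : c ∈ H2) (z : Circle) :
    IsRotationAbout c (rotAbout hc z) where
  lor_map x y := by
    have h : ∀ x, boost c (rotAbout hc z x) = rotOrigin z (boost c x) := fun x =>
      (boostEquiv hc).apply_symm_apply _
    rw [← boost_lor_map hc, h, h, (rotOrigin_isRotationAbout z).lor_map, boost_lor_map hc]
  det_eq := by
    have := LinearMap.det_conj (rotOrigin z) (boostEquiv hc).symm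
    rw [LinearEquiv.symm_symm] at this
    rw [← (rotOrigin_isRotationAbout z).det_eq, ← this]
    rfl
  map_center := by
    rw [rotAbout_apply, boost_self hc, (rotOrigin_isRotationAbout z).map_center,
      LinearEquiv.symm_apply_eq, boostEquiv_apply, boost_self hc]

/-- A rotationally invariant closed embedded curve in a horizontal plane is a circle. -/
lemma exists_radius_of_rotInvariant {c : L3} (hc : c ∈ H2) {t₀ : ℝ} {Γ : Set L3R}
    (hΓ : Γ ⊆ {P | P ∈ H2R ∧ P.2 = t₀}) (hcurve : IsClosedEmbeddedCurve Γ)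
    (hrot : RotInvariant c Γ) : ∃ a, 1 < a ∧ ∀ P ∈ Γ, lor P.1 c = -a := by
  obtain ⟨γ, hγ, rfl⟩ := hcurve
  -- At fixed height the axis contains one point, which cannot hold both `γ 1` and `γ (-1)`.
  obtain ⟨z₀, hz₀⟩ : ∃ z, (γ z).1 ≠ c := by
    by_contra hall
    push Not at hall
    have h1 : γ 1 = γ (Circle.exp Real.pi) :=
      Prod.ext ((hall _).trans (hall _).symm) ((hΓ ⟨_, rfl⟩).2.trans (hΓ ⟨_, rfl⟩).2.symm)
    have h2 := congrArg (fun z : Circle => (z : ℂ)) (hγ.injective h1)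
    simp [Circle.coe_exp] at h2
    norm_num [Complex.ext_iff] at h2
  have hmem : (γ z₀).1 ∈ H2 := (hΓ ⟨z₀, rfl⟩).1
  set x := (γ z₀).1 with hx
  set f : Circle → L3R := fun z => (rotAbout hc z x, (γ z₀).2) with hf
  have hfΓ : ∀ z, f z ∈ range γ := by
    intro z
    rw [← hrot _ (rotAbout_isRotationAbout hc z)]
    exact ⟨γ z₀, ⟨z₀, rfl⟩, rfl⟩
  have hfc : Continuous f := by
    refine Continuous.prodMk ?_ continuous_const
    simp only [rotAbout_apply]
    refine (LinearMap.continuous_of_finiteDimensional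
      (boostEquiv hc).symm.toLinearMap).comp ?_
    simp only [rotOrigin_apply]
    have h1 : Continuous fun z : Circle => (z : ℂ).re :=
      Complex.continuous_re.comp continuous_circle_coe
    have h2 : Continuous fun z : Circle => (z : ℂ).im :=
      Complex.continuous_im.comp continuous_circle_coe
    refine continuous_pi fun i => ?_
    fin_cases i
    · simp only [Fin.zero_eta, Matrix.cons_val_zero]; fun_prop
    · simp only [Fin.mk_one, Matrix.cons_val_one, Matrix.cons_val_zero]; fun_prop
    · simp only [Fin.reduceFinMk, Matrix.cons_val]; fun_prop
  set w := boost c x with hw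
  -- Off the axis the rotations act freely, so the orbit map `f` is injective.
  have hw01 : w 0 ^ 2 + w 1 ^ 2 ≠ 0 := by
    intro hzero
    have h0 : w 0 = 0 := by nlinarith [sq_nonneg (w 0), sq_nonneg (w 1)]
    have h1 : w 1 = 0 := by nlinarith [sq_nonneg (w 0), sq_nonneg (w 1)]
    have hwH : w ∈ H2 := (map_mem_H2_iff (boost_lor_map hc) hc origin_mem_H2 (boost_self hc) x).2 hmem
    have h2 := coord_two_of_mem_H2 hwH
    have : w = origin := by
      ext i
      fin_cases i
      · simpa [origin] using h0
      · simpa [origin] using h1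
      · simp [origin, h2, h0, h1]
    exact hz₀ ((boostEquiv hc).injective (by
      rw [boostEquiv_apply, boostEquiv_apply, boost_self hc, ← hw, this]))
  have hfi : Function.Injective f := by
    intro z z' hzz
    have h1 : rotAbout hc z x = rotAbout hc z' x := congrArg Prod.fst hzz
    rw [rotAbout_apply, rotAbout_apply] at h1
    have h2 := (boostEquiv hc).symm.injective h1
    rw [rotOrigin_apply, rotOrigin_apply, ← hw] at h2
    have h3 := congrFun h2 0
    have h4 := congrFun h2 1
    simp only [Matrix.cons_val_zero, Matrix.cons_val_one] at h3 h4
    ext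
    apply Complex.ext
    · refine mul_right_cancel₀ hw01 ?_
      linear_combination w 0 * h3 + w 1 * h4
    · refine mul_right_cancel₀ hw01 ?_
      linear_combination w 0 * h4 - w 1 * h3
  set Φ := hγ.toHomeomorph
  -- Read through `γ`, the orbit is an injective self-map of the circle, hence onto: `Γ` is a single
  -- orbit.
  set g : Circle → Circle := fun z => Φ.symm ⟨f z, hfΓ z⟩ with hg
  have hgc : Continuous g := Φ.symm.continuous.comp (hfc.subtype_mk hfΓ)
  have hgi : Function.Injective g := fun a b hab =>
    hfi (congrArg Subtype.val (Φ.symm.injective hab))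
  have hgs := Circle.surjective_of_injective hgc hgi
  refine ⟨-lor x c, neg_lor_gt_one hmem hc hz₀, ?_⟩
  rintro P ⟨z, rfl⟩
  obtain ⟨z', hz'⟩ := hgs z
  have h1 : γ z = f z' := by
    rw [← hz']
    exact congrArg Subtype.val (Φ.apply_symm_apply ⟨f z', hfΓ z'⟩)
  have hR := rotAbout_isRotationAbout hc z'
  rw [h1, neg_neg]
  change lor (rotAbout hc z' x) c = lor x c
  rw [← hR.lor_map x c, hR.map_center]

/-! ### The projection of the surface fills a disc -/

/-- A compact set that is a neighbourhood of each of its points off the circle of radius `r`, and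
has an interior point, is the disc of radius `r`. -/
lemma eq_closedBall_of_mem_nhds {N : Set E2} (hN : IsCompact N) {r : ℝ} (hr : 0 < r)
    (hopen : ∀ x ∈ N, ‖x‖ ≠ r → N ∈ 𝓝 x) (hint : (interior N).Nonempty) :
    N = Metric.closedBall 0 r := by
  have hsub : N ⊆ Metric.closedBall 0 r := by
    obtain ⟨x, hx, hmax⟩ := hN.exists_isMaxOn (hint.mono interior_subset)
      continuous_norm.continuousOn
    have hxr : ‖x‖ ≤ r := by
      -- A farthest point outside the disc would have a neighbourhood in `N` and could be pushed
      -- radially outwards.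
      by_contra hlt
      have hlt := not_le.1 hlt
      have h1 := hopen x hx hlt.ne'
      have h2 : Filter.Tendsto (fun s : ℝ => (1 + s) • x) (𝓝[>] 0) (𝓝 x) := by
        have : Continuous fun s : ℝ => (1 + s) • x := by fun_prop
        simpa using (this.tendsto 0).mono_left nhdsWithin_le_nhds
      obtain ⟨s, hs1, hs2⟩ := ((h2.eventually h1).and self_mem_nhdsWithin).exists
      have hs0 : 0 < s := hs2
      have h3 : ‖(1 + s) • x‖ ≤ ‖x‖ := hmax hs1
      rw [norm_smul, Real.norm_of_nonneg (by linarith)] at h3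
      nlinarith [hr.trans hlt]
    intro y hy
    rw [mem_closedBall_zero_iff]
    exact (hmax hy).trans hxr
  refine hsub.antisymm ?_
  -- The open disc is connected and covered by the disjoint open sets `interior N` and `Nᶜ`.
  have hball : Metric.ball 0 r ⊆ interior N := by
    refine IsPreconnected.subset_left_of_subset_union isOpen_interior hN.isClosed.isOpen_compl
      (disjoint_compl_right.mono_left interior_subset) ?_ ?_ (convex_ball _ _).isPreconnected
    · intro x hx
      by_cases hxN : x ∈ N
      · left
        rw [mem_interior_iff_mem_nhds]
        exact hopen x hxN (mem_ball_zero_iff.1 hx).ne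
      · exact Or.inr hxN
    · obtain ⟨x, hx⟩ := hint
      have := interior_mono hsub hx
      rw [interior_closedBall _ hr.ne'] at this
      exact ⟨x, this, hx⟩
  rw [← closure_ball _ hr.ne']
  exact hN.isClosed.closure_subset_iff.2 (hball.trans interior_subset)

section Projection

variable {H : Type*} [TopologicalSpace H] {I : ModelWithCorners ℝ E2 H}
  {S : Type*} [TopologicalSpace S] [ChartedSpace H S]

/-- The first two coordinates of a linear image of the `ℍ²`-component. -/
def planeProj (A : L3 →ₗ[ℝ] L3) : L3R →L[ℝ] E2 :=
  (EuclideanSpace.equiv (Fin 2) ℝ).symm.toContinuousLinearMap.comp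
    ((ContinuousLinearMap.pi fun i : Fin 2 =>
      ContinuousLinearMap.proj (R := ℝ) (φ := fun _ : Fin 3 => ℝ) (Fin.castSucc i)).comp
      ((LinearMap.toContinuousLinearMap A).comp (ContinuousLinearMap.fst ℝ L3 ℝ)))

lemma planeProj_zero (A : L3 →ₗ[ℝ] L3) (P : L3R) : planeProj A P 0 = A P.1 0 := rfl

lemma planeProj_one (A : L3 →ₗ[ℝ] L3) (P : L3R) : planeProj A P 1 = A P.1 1 := rfl

lemma norm_planeProj_boost_sq {c : L3} (hc : c ∈ H2) {P : L3R} (hP : P.1 ∈ H2) :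
    ‖planeProj (boost c) P‖ ^ 2 = lor P.1 c ^ 2 - 1 := by
  rw [EuclideanSpace.real_norm_sq_eq, Fin.sum_univ_two, planeProj_zero, planeProj_one,
    ← boost_lor_map hc P.1 c, boost_self hc, lor_origin]
  have := boost_lor_map hc P.1 P.1
  rw [hP.1] at this
  simp only [lor] at this
  linarith

/-- A tangent vector killed by the projection has no horizontal part, by tangency to the
hyperboloid; it is orthogonal to the height gradient, whose vertical component is `1`, so it is
zero. The inverse function theorem then makes the projection open at `y`. -/
lemma range_planeProj_mem_nhds [IsManifold I ∞ S] {ψ : S → L3R} (h : IsImmersedSurface I ψ)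
    {U : ℝ → ℝ} (hU : IsBowlProfile U) {c : L3} (hc : c ∈ H2) {h₀ : ℝ}
    (hh : ∀ q, heightAbove U c (ψ q) = h₀) {q : S} {y : E2} (hy : y ∈ (extChartAt I q).target)
    (hr : range I ∈ 𝓝 y) :
    range (fun q => planeProj (boost c) (ψ q)) ∈
      𝓝 (planeProj (boost c) (ψ ((extChartAt I q).symm y))) := by
  set Ψ := ψ ∘ (extChartAt I q).symm with hΨdef
  have hΨ : ContDiffAt ℝ ∞ Ψ y := contDiffAt_comp_extChartAt_symm h.smooth hy hr
  have hΨ2 : ContDiffAt ℝ 2 Ψ y := hΨ.of_le ENat.LEInfty.out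
  have hX : ∀ᶠ x in 𝓝 y, lor (Ψ x).1 (Ψ x).1 = -1 :=
    Filter.Eventually.of_forall fun x => (h.mem _).1
  obtain ⟨L, hLi, hL⟩ := fderiv_comp_extChartAt_symm h.smooth hy hr
  have hinj : Function.Injective (fderiv ℝ Ψ y) := by
    intro v w hvw
    rw [hL, hL] at hvw
    exact hLi (h.injective_mfderiv _ hvw)
  have hstrict : HasStrictFDerivAt (fun x => planeProj (boost c) (Ψ x))
      ((planeProj (boost c)).comp (fderiv ℝ Ψ y)) y :=
    (planeProj (boost c)).hasStrictFDerivAt.comp y (hΨ.hasStrictFDerivAt (by simp))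
  have hinj' : Function.Injective ((planeProj (boost c)).comp (fderiv ℝ Ψ y)) := by
    rw [injective_iff_map_eq_zero]
    intro v hv
    set V := fderiv ℝ Ψ y v with hV
    have hv' : planeProj (boost c) V = 0 := hv
    have h0 : boost c V.1 0 = 0 := by rw [← planeProj_zero, hv']; rfl
    have h1 : boost c V.1 1 = 0 := by rw [← planeProj_one, hv']; rfl
    have horth : lor (boost c (Ψ y).1) (boost c V.1) = 0 := by
      rw [boost_lor_map hc]
      exact lor_fderiv_eq_zero hΨ2 hX v
    have hpos : 0 < boost c (Ψ y).1 2 :=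
      ((map_mem_H2_iff (boost_lor_map hc) hc origin_mem_H2 (boost_self hc) _).2 (h.mem _)).2
    have h2 : boost c V.1 2 = 0 := by
      rw [lor, h0, h1] at horth
      have : boost c (Ψ y).1 2 * boost c V.1 2 = 0 := by linarith
      exact (mul_eq_zero.1 this).resolve_left hpos.ne'
    have hV1 : V.1 = 0 := by
      refine injective_of_lor_map (boost_lor_map hc) ?_
      rw [map_zero]
      ext i
      fin_cases i
      · exact h0
      · exact h1
      · exact h2
    have ht : 0 ≤ lor (Ψ y).1 c ^ 2 - 1 := sub_nonneg.2 (one_le_lor_sq (h.mem _).1 hc.1)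
    have hg := heightGradient_orthogonal (c := c) (v := v) hΨ2 hX
      ((hU _ ht).1.differentiableAt (by simp)).hasDerivAt (by
        simp only [hΨdef, Function.comp, hh, deriv_const])
    rw [← hV, prodForm, hV1] at hg
    have hV2 : V.2 = 0 := by simpa [lor, heightGradient] using hg
    have hVz : V = 0 := Prod.ext hV1 hV2
    exact hinj (hVz.trans (map_zero _).symm)
  have hsurj : ((planeProj (boost c)).comp (fderiv ℝ Ψ y)).range = ⊤ :=
    LinearMap.range_eq_top.2 (LinearMap.injective_iff_surjective.1 hinj')
  have := hstrict.map_nhds_eq_of_surj hsurj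
  change _ ∈ 𝓝 (planeProj (boost c) (Ψ y))
  rw [← this, Filter.mem_map]
  exact Filter.univ_mem' fun x => ⟨_, rfl⟩

/-- This gives the projected set an interior point even if the given `q` lies on the boundary. -/
lemma exists_interior_chart_point [IsManifold I ∞ S] (q : S) :
    ∃ y ∈ (extChartAt I q).target, range I ∈ 𝓝 y := by
  have h1 := extChartAt_target_mem_nhdsWithin (I := I) q
  obtain ⟨O, hO, hqO, hsub⟩ := mem_nhdsWithin.1 h1
  have h2 : extChartAt I q q ∈ closure (interior (range I)) :=
    I.range_subset_closure_interior (extChartAt_target_subset_range q (mem_extChartAt_target q))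
  obtain ⟨y, hyO, hyi⟩ := mem_closure_iff.1 h2 O hO hqO
  exact ⟨y, hsub ⟨hyO, interior_subset hyi⟩, mem_interior_iff_mem_nhds.1 hyi⟩

/-- A compact surface on a bowl soliton around `c` whose boundary is at constant distance from the
axis is a full piece of the bowl soliton. -/
lemma range_eq_bowl_piece [IsManifold I ∞ S] [CompactSpace S] [Nonempty S] {ψ : S → L3R}
    (h : IsImmersedSurface I ψ)
    {U : ℝ → ℝ} (hU : IsBowlProfile U) {c : L3} (hc : c ∈ H2) {h₀ a : ℝ} (ha : 1 < a)
    (hh : ∀ q, heightAbove U c (ψ q) = h₀) (hbd : ∀ q ∈ I.boundary S, lor (ψ q).1 c = -a) :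
    range ψ = {P : L3R | P.1 ∈ H2 ∧ (lor P.1 c ^ 2 ≤ a ^ 2 ∧ heightAbove U c P = h₀)} := by
  set G : S → E2 := fun q => planeProj (boost c) (ψ q) with hG
  have hl : 0 < a ^ 2 - 1 := by nlinarith
  set r := √(a ^ 2 - 1) with hr
  have hr0 : 0 < r := Real.sqrt_pos.2 hl
  have hrr : r ^ 2 = a ^ 2 - 1 := Real.sq_sqrt hl.le
  have hGc : Continuous G := (planeProj (boost c)).continuous.comp h.smooth.continuous
  have hGn : ∀ q, ‖G q‖ ^ 2 = lor (ψ q).1 c ^ 2 - 1 := fun q =>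
    norm_planeProj_boost_sq hc (h.mem q)
  have hrange : range G = Metric.closedBall 0 r := by
    refine eq_closedBall_of_mem_nhds (isCompact_range hGc) hr0 ?_ ?_
    · rintro _ ⟨q, rfl⟩ hne
      have hint : I.IsInteriorPoint q := by
        rcases I.isInteriorPoint_or_isBoundaryPoint q with hq | hq
        · exact hq
        · refine absurd ?_ hne
          have := hGn q
          rw [hbd q hq, neg_sq, ← hrr] at this
          exact (pow_left_inj₀ (norm_nonneg _) hr0.le two_ne_zero).1 this
      have := range_planeProj_mem_nhds h hU hc hh (mem_extChartAt_target (I := I) q)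
        (range_mem_nhds_isInteriorPoint hint)
      rwa [extChartAt_to_inv] at this
    · obtain ⟨q⟩ := ‹Nonempty S›
      obtain ⟨y, hy, hr⟩ := exists_interior_chart_point (I := I) q
      exact ⟨_, mem_interior_iff_mem_nhds.2 (range_planeProj_mem_nhds h hU hc hh hy hr)⟩
  ext P
  constructor
  · rintro ⟨q, rfl⟩
    refine ⟨h.mem q, ?_, hh q⟩
    have h1 : G q ∈ Metric.closedBall 0 r := hrange ▸ mem_range_self q
    rw [mem_closedBall_zero_iff] at h1
    have h2 := pow_le_pow_left₀ (norm_nonneg _) h1 2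
    rw [hGn, hrr] at h2
    linarith
  · rintro ⟨h1, h2, h3⟩
    have hm : planeProj (boost c) P ∈ range G := by
      rw [hrange, mem_closedBall_zero_iff]
      refine (pow_le_pow_iff_left₀ (norm_nonneg _) hr0.le two_ne_zero).1 ?_
      rw [norm_planeProj_boost_sq hc h1, hrr]
      linarith
    -- Equal projections give equal points of `ℍ²`, the third coordinate being determined by the
    -- others; equal height above `U` then gives equal `z`.
    obtain ⟨q, hq⟩ := hm
    have hmap := map_mem_H2_iff (boost_lor_map hc) hc origin_mem_H2 (boost_self hc)
    have e0 : boost c (ψ q).1 0 = boost c P.1 0 := congrArg (fun x : E2 => x 0) hq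
    have e1 : boost c (ψ q).1 1 = boost c P.1 1 := congrArg (fun x : E2 => x 1) hq
    have e2 : boost c (ψ q).1 2 = boost c P.1 2 := by
      rw [coord_two_of_mem_H2 ((hmap _).2 (h.mem q)), coord_two_of_mem_H2 ((hmap _).2 h1), e0, e1]
    have e : (ψ q).1 = P.1 := by
      refine injective_of_lor_map (boost_lor_map hc) ?_
      ext i
      fin_cases i
      · exact e0
      · exact e1
      · exact e2
    refine ⟨q, Prod.ext e ?_⟩
    have h4 := hh q
    rw [heightAbove, e] at h4
    rw [heightAbove] at h3
    linarith

end Projection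

end

/-! ### Conclusion -/

theorem mainTheorem7
    {S : Type*} [TopologicalSpace S] [CompactSpace S]
    [ChartedSpace (EuclideanHalfSpace 2) S] [IsManifold (𝓡∂ 2) ∞ S]
    (ψ : S → L3R) (hemb : IsEmbedding ψ) (hsol : IsTranslatingSoliton (𝓡∂ 2) ψ)
    (c : L3) (hc : c ∈ H2) (t₀ : ℝ) (Γ : Set L3R)
    (hΓ : Γ ⊆ {P | P ∈ H2R ∧ P.2 = t₀}) (hcurve : IsClosedEmbeddedCurve Γ)
    (hrot : RotInvariant c Γ)
    (hbdry : ψ '' (𝓡∂ 2).boundary S = Γ) :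
    RotInvariant c (range ψ) ∧
      ∃ B : Set L3R, IsBowlSoliton B ∧
        ∃ T : L3R → L3R, IsTranslation T ∧
          ∃ σ : ℝ, 0 < σ ∧ T '' range ψ = B ∩ solidCylinder σ := by
  obtain ⟨η, hη⟩ := hsol
  obtain ⟨U, hU⟩ := exists_isBowlProfile
  obtain ⟨a, ha, hΓa⟩ := exists_radius_of_rotInvariant hc hΓ hcurve hrot
  have hbd : ∀ q ∈ (𝓡∂ 2).boundary S, ψ q ∈ Γ := fun q hq => hbdry ▸ mem_image_of_mem ψ hq
  have hne : Nonempty S := by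
    obtain ⟨γ, -, hγ⟩ := hcurve
    have h1 : γ 1 ∈ ψ '' (𝓡∂ 2).boundary S := by rw [hbdry, ← hγ]; exact mem_range_self 1
    exact ⟨h1.choose⟩
  -- The vertical shift for which the bowl around `l` passes through the circle `Γ`; it is undone by
  -- the translation below.
  set h₀ := t₀ - U (a ^ 2 - 1) with hh₀
  have hh : ∀ q, heightAbove U c (ψ q) = h₀ := by
    refine hη.heightAbove_eq hU hc.1 (l := a ^ 2 - 1) fun q hq => ?_
    have h1 := hΓa _ (hbd q hq)
    have h2 := (hΓ (hbd q hq)).2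
    rw [heightAbove, h1, h2, neg_sq]
    exact ⟨rfl, rfl⟩
  have hM := range_eq_bowl_piece hη.immersed hU hc ha hh fun q hq => hΓa _ (hbd q hq)
  refine ⟨?_, _, hU.isBowlSoliton, fun P => (boost c P.1, P.2 + -h₀),
    ⟨boost c, boost_isHypTranslation hc, -h₀, fun P => rfl⟩, Real.arcosh a,
    Real.arcosh_pos ha, ?_⟩
  · rw [hM]
    exact rotInvariant_setOf hc fun b z => b ^ 2 ≤ a ^ 2 ∧ z - U (b ^ 2 - 1) = h₀
  · have hmap := map_mem_H2_iff (boost_lor_map hc) hc origin_mem_H2 (boost_self hc)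
    have hlor : ∀ x, lor (boost c x) origin = lor x c := fun x => by
      rw [← boost_lor_map hc x c, boost_self hc]
    have hdist : ∀ x ∈ H2, hdist origin x ≤ Real.arcosh a ↔ lor x origin ^ 2 ≤ a ^ 2 := by
      intro x hx
      have h1 := lor_neg_of_mem hx origin_mem_H2
      rw [hdist, lor_comm origin x, Real.arcosh_le_arcosh (by linarith) (by linarith),
        ← neg_sq (lor x origin), pow_le_pow_iff_left₀ (by linarith) (by linarith) two_ne_zero]
    rw [hM]
    ext P
    constructor
    · rintro ⟨P, ⟨h1, h2, h3⟩, rfl⟩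
      have h4 := (hmap P.1).2 h1
      refine ⟨⟨h4, ?_⟩, h4, (hdist _ h4).2 (by simpa only [hlor] using h2)⟩
      simp only [heightAbove, hlor] at h3 ⊢
      linarith
    · rintro ⟨⟨h1, h2⟩, -, h3⟩
      obtain ⟨x, hx⟩ := surjective_of_lor_map (boost_lor_map hc) P.1
      have h4 := (hdist _ h1).1 h3
      rw [← hx, hlor] at h4
      rw [heightAbove, ← hx, hlor] at h2
      refine ⟨(x, P.2 + h₀), ⟨(hmap x).1 (hx ▸ h1), h4, ?_⟩, Prod.ext hx ?_⟩
      · simp only [heightAbove]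
        linarith
      · simp
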